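/- There is a function $\mu:\mathbb N\to\mathbb N$ with $\mu(d)\le d^d$ for all $d$, $\mu(2)=3$ and $\mu(3)=6$ such that the following holds. Let $P=\{x\in\mathbb R^d:\langle a^i,x\rangle\le b_i,\ 1\le i\le m\}$ be a bounded polyhedron of dimension $d$ which is simple, i.e. every $k$-dimensional face, $0\le k\le d-1$, lies in exactly $d-k$ facets. Then $P=\{x\in\mathbb R^d:\mathfrak p_1(x)\ge 0,\dots,\mathfrak p_{\mu(d)}(x)\ge 0\}$ for polynomials $\mathfrak p_1,\dots,\mathfrak p_{\mu(d)}\in\mathbb R[x_1,\dots,x_d]$ constructed explicitly from the $a^i,b_i$ as follows. Discard every inequality $i$ for which $P\cap\{\langle a^i,x\rangle=b_i\}$ is not a facet, and among inequalities defining the same facet keep only the first; let $I$ be the set of remaining indices. Let $h(u)=\max_{x\in P}\langle u,x\rangle$, and let $\mathcal F_k$ be the set of $k$-dimensional faces of $P$. For $F\in\mathcal F_k$ let $[F]_1<\dots<[F]_{d-k}$ be the indices in $I$ of the facets containing $F$, and for $w\in\mathbb N^{d-k}$ put $a(F,w)=\sum_{j=1}^{d-k}w_j\,a^{[F]_j}$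 and $$\mathfrak p_{k,w}(x)=\prod_{F\in\mathcal F_k}\bigl[h(a(F,w))-\langle a(F,w),x\rangle\bigr].$$ The weight sets are $\mathcal W_{d-1}=\{(1)\}$, $\mathcal W_{d-2}=\{(1,1)\}$, $\mathcal W_{d-3}=\{(1,1,2),(1,2,1),(2,1,1)\}$, and $\mathcal W_{d-n}=\{(2^{l_1},\dots,2^{l_n}):0\le l_i\le n-2\}$ for $4\le n\le d$. For $u,v\in\mathbb R^d$ let $\epsilon(u,v)\in[0,\infty]$ be the distance of $P$ from $\{y:\langle u,y\rangle\ge h(u),\ \langle v,y\rangle\ge h(v)\}$ (equal to $\infty$ if this set is empty). There exist $\epsilon>0$ smaller than all the positive numbers among $\epsilon(a(F,w),a(G,w))$, where $0\le k\le d-1$, $F\ne G$ in $\mathcal F_k$, $w\in\mathcal W_k$. For every such $\epsilon$ there exist integers $q\ge0$ with $$q>\frac{\ln |I|}{2\ln\bigl(1+\frac{2\epsilon}{(d+1)\,\mathrm{diam}(P)}\bigr)},$$ and for every such $\epsilon$ and $q$ the polynomials $\mathfrak p_1,\dots,\mathfrak p_{\mu(d)}$ can be taken to be (with repetitions allowed)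 exactly the polynomials $\mathfrak p_{k,w}$, $0\le k\le d-1$, $w\in\mathcal W_k$, together with, if $d\ge2$, the polynomial $$1-\sum_{i\in I}\frac1{|I|}\left[\frac{2\langle a^i,x\rangle-h(a^i)+h(-a^i)}{h(a^i)+h(-a^i)}\right]^{2q}.$$ (For $d=0$ the convention is $0^0=1$; the degenerate quotient in the bound on $q$ is then read as $0$.) -/

import Mathlib

open scoped ENNReal

noncomputable section

namespace PolyRep

/-- The polyhedron `{x ∈ ℝ^d : ⟨a i, x⟩ ≤ b i for all i}`. -/
def polyhedron {d m : ℕ} (a : Fin m → EuclideanSpace ℝ (Fin d)) (b : Fin m → ℝ) :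
    Set (EuclideanSpace ℝ (Fin d)) :=
  {x | ∀ i, inner ℝ (a i) x ≤ b i}

/-- `F` is nonempty and its affine hull has dimension `k`. -/
def HasDim {d : ℕ} (F : Set (EuclideanSpace ℝ (Fin d))) (k : ℕ) : Prop :=
  F.Nonempty ∧ Module.finrank ℝ (vectorSpan ℝ F) = k

/-- The set of `k`-dimensional faces of `P`: the nonempty sets of maximizers on `P` of a linear
functional whose affine hull has dimension `k`. -/
def faces {d : ℕ} (P : Set (EuclideanSpace ℝ (Fin d))) (k : ℕ) :
    Set (Set (EuclideanSpace ℝ (Fin d))) :=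
  {F | IsExposed ℝ P F ∧ HasDim F k}

/-- The facets of `P ⊆ ℝ^d`: the faces of dimension `d - 1`
(written so that there are none for `d = 0`). -/
def facets {d : ℕ} (P : Set (EuclideanSpace ℝ (Fin d))) :
    Set (Set (EuclideanSpace ℝ (Fin d))) :=
  {F | ∃ k, k + 1 = d ∧ F ∈ faces P k}

/-- Every `k`-dimensional face, `0 ≤ k ≤ d - 1`, lies in exactly `d - k` facets. -/
def IsSimple {d : ℕ} (P : Set (EuclideanSpace ℝ (Fin d))) : Prop :=
  ∀ k < d, ∀ F ∈ faces P k, {G | G ∈ facets P ∧ F ⊆ G}.ncard = d - k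

/-- The semialgebraic set `{x ∈ ℝ^d : 𝔭 i (x) ≥ 0 for all i}`. -/
def nonnegSet {d : ℕ} {ι : Type} (p : ι → MvPolynomial (Fin d) ℝ) :
    Set (EuclideanSpace ℝ (Fin d)) :=
  {x | ∀ i, 0 ≤ MvPolynomial.eval (fun j => x j) (p i)}

/-- The support function `h(u) = sup {⟨u, x⟩ : x ∈ P}`. -/
def supportFn {d : ℕ} (P : Set (EuclideanSpace ℝ (Fin d))) (u : EuclideanSpace ℝ (Fin d)) : ℝ :=
  sSup ((fun x => inner ℝ u x) '' P)

/-- The linear form `⟨u, x⟩` as a polynomial in `x`. -/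
def linForm {d : ℕ} (u : EuclideanSpace ℝ (Fin d)) : MvPolynomial (Fin d) ℝ :=
  ∑ j, MvPolynomial.C (u j) * MvPolynomial.X j

open Classical in
/-- The indices of an irredundant subsystem: those `i` for which `⟨a i, x⟩ = b i` cuts out a facet,
where among inequalities that define the same facet only the first one is kept.
If the system is irredundant, these are all the indices. -/
def facetIdx {d m : ℕ} (a : Fin m → EuclideanSpace ℝ (Fin d)) (b : Fin m → ℝ) :
    Finset (Fin m) :=
  Finset.univ.filter fun i =>
    polyhedron a b ∩ {x | inner ℝ (a i) x = b i} ∈ facets (polyhedron a b) ∧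
    ∀ j < i, polyhedron a b ∩ {x | inner ℝ (a j) x = b j} ≠
      polyhedron a b ∩ {x | inner ℝ (a i) x = b i}

open Classical in
/-- The indices of the facets containing the face `F`. -/
def incident {d m : ℕ} (a : Fin m → EuclideanSpace ℝ (Fin d)) (b : Fin m → ℝ)
    (F : Set (EuclideanSpace ℝ (Fin d))) : Finset (Fin m) :=
  (facetIdx a b).filter fun i => ∀ x ∈ F, inner ℝ (a i) x = b i

/-- The support vector `a(F, w) = ∑ⱼ wⱼ a^{[F]ⱼ}`, where `[F]₁ < ⋯ < [F]ₙ` are the indices of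
the facets containing `F`. For a `k`-face of a simple `d`-polytope there are
`n = d - k` of them, so the second branch does not occur. -/
def supportVec {d m : ℕ} (a : Fin m → EuclideanSpace ℝ (Fin d)) (b : Fin m → ℝ)
    (F : Set (EuclideanSpace ℝ (Fin d))) {n : ℕ} (w : Fin n → ℕ) : EuclideanSpace ℝ (Fin d) :=
  if h : (incident a b F).card = n then
    ∑ j, (w j : ℝ) • a ((incident a b F).orderEmbOfFin h j)
  else 0

/-- The weight vectors used at the faces of codimension `n`. -/
def weights : (n : ℕ) → Finset (Fin n → ℕ)
  | 1 => {![1]}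
  | 3 => {![1, 1, 2], ![1, 2, 1], ![2, 1, 1]}
  | n => Fintype.piFinset fun _ => (Finset.range (n - 1)).image fun l => 2 ^ l

/-- `𝔭_{k,w}(x) = ∏_F [h(a(F,w)) - ⟨a(F,w), x⟩]`, the product over all `k`-faces `F`
(a finite product, as a polyhedron has finitely many faces). -/
def facePoly {d m : ℕ} (a : Fin m → EuclideanSpace ℝ (Fin d)) (b : Fin m → ℝ)
    (k : ℕ) {n : ℕ} (w : Fin n → ℕ) : MvPolynomial (Fin d) ℝ :=
  ∏ᶠ F ∈ faces (polyhedron a b) k,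
    (MvPolynomial.C (supportFn (polyhedron a b) (supportVec a b F w))
      - linForm (supportVec a b F w))

/-- The distance of `P` from `U(u,v) = {y : ⟨u,y⟩ ≥ h(u), ⟨v,y⟩ ≥ h(v)}`
(it is `∞` if `U(u,v)` is empty). -/
def sepDist {d : ℕ} (P : Set (EuclideanSpace ℝ (Fin d))) (u v : EuclideanSpace ℝ (Fin d)) :
    ℝ≥0∞ :=
  ⨅ x ∈ P, ⨅ y ∈ {y | supportFn P u ≤ inner ℝ u y ∧ supportFn P v ≤ inner ℝ v y}, edist x y

/-- The affine function `(2⟨u,x⟩ - h(u) + h(-u)) / (h(u) + h(-u))`, which maps `P` onto `[-1,1]`. -/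
def widthForm {d : ℕ} (P : Set (EuclideanSpace ℝ (Fin d))) (u : EuclideanSpace ℝ (Fin d)) :
    MvPolynomial (Fin d) ℝ :=
  MvPolynomial.C (supportFn P u + supportFn P (-u))⁻¹ *
    (2 * linForm u - MvPolynomial.C (supportFn P u) + MvPolynomial.C (supportFn P (-u)))

/-- The approximating polynomial `∑ᵢ (1/m) 𝔳ᵢ(x)^{2q}`, the sum over the `m` facets. -/
def approxPoly {d m : ℕ} (a : Fin m → EuclideanSpace ℝ (Fin d)) (b : Fin m → ℝ) (q : ℕ) :
    MvPolynomial (Fin d) ℝ :=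
  ∑ i ∈ facetIdx a b,
    MvPolynomial.C (((facetIdx a b).card : ℝ)⁻¹) * widthForm (polyhedron a b) (a i) ^ (2 * q)

/-- `ε` is positive and smaller than all the positive distances from `P` to
`U(a(F,w), a(G,w))`, for distinct faces `F`, `G` of the same dimension `k` and weights `w`. -/
def IsGoodEps {d m : ℕ} (a : Fin m → EuclideanSpace ℝ (Fin d)) (b : Fin m → ℝ) (ε : ℝ) : Prop :=
  0 < ε ∧ ∀ k < d, ∀ F ∈ faces (polyhedron a b) k, ∀ G ∈ faces (polyhedron a b) k, F ≠ G →
    ∀ w ∈ weights (d - k),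
      0 < sepDist (polyhedron a b) (supportVec a b F w) (supportVec a b G w) →
      ENNReal.ofReal ε < sepDist (polyhedron a b) (supportVec a b F w) (supportVec a b G w)

/-- The exponent bound `q > ln m / (2 ln (1 + 2ε / ((d+1) diam P)))`, with `m` facets. -/
def IsGoodExp {d m : ℕ} (a : Fin m → EuclideanSpace ℝ (Fin d)) (b : Fin m → ℝ) (ε : ℝ)
    (q : ℕ) : Prop :=
  Real.log (facetIdx a b).card /
    (2 * Real.log (1 + 2 * ε / ((d + 1) * Metric.diam (polyhedron a b)))) < q

/-- The constructed polynomials: all `𝔭_{k,w}` with `0 ≤ k ≤ d - 1` and `w` a weight vector for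
codimension `d - k`, and, if `d ≥ 2`, one minus the approximating polynomial
(in dimension one it is not needed). -/
def system {d m : ℕ} (a : Fin m → EuclideanSpace ℝ (Fin d)) (b : Fin m → ℝ) (q : ℕ) :
    Set (MvPolynomial (Fin d) ℝ) :=
  {f | ∃ k < d, ∃ w ∈ weights (d - k), f = facePoly a b k w} ∪
    {f | 2 ≤ d ∧ f = 1 - approxPoly a b q}

end PolyRep

end

/-!
Let `I` be the indices of the facets and `sᵢ(x) = ⟨aⁱ, x⟩ - bᵢ`, so that the polytope is
`{sᵢ ≤ 0 for i ∈ I}` (`mem_polyhedron_iff`). A face is the intersection of the facets containing it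
(`mem_face_iff`), so `⟨a(F,w), x⟩ - h(a(F,w))` is the weighted sum of the `sᵢ(x)` over the facets
through `F` (`supportVec_excess`), and for positive weights its only zeros on `P` are the points of
`F` (`mem_face_of_maximal`). All polynomials are clearly nonnegative on `P`.

Conversely let all of them be nonnegative at `x`. For `d ≥ 2` the last of them, one minus the
approximating polynomial, forces `x` to be within `ε` of `P` (`exists_dist_le_of_approxPoly_le`):
Helly's theorem provides a point of `P` that is at least the `(d+1)`-st part of the width away from
each facet hyperplane, and `x` lies in the copy of `P` enlarged by `1 + ε / diam P` about that point.

If some support inequality of a `k`-face `F` is violated at `x`, then, the product over all `k`-faces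
being nonnegative, another `k`-face `G` has a support form that is at least its maximum over `P` at
`x`. As `x` is close to `P`, the choice of `ε` makes `F` and `G` meet. Because `P` is simple, the
facets through `F ∩ G` are exactly those through `F` or `G` (`incident_inter`), so adding up the two
weighted sums and rounding the weights to powers of two in the favourable direction
(`IsWeighting.exists_union`) gives a violated support inequality of the smaller face `F ∩ G`. Thus by
induction on `k` no support inequality is violated, in particular none of those of the facets. In
dimension one, where there is no approximating polynomial, the two vertices cannot both be
violated.
-/

namespace PolyRep

/-! ### Relative interior points and affine hulls -/

/-- A convex set on which finitely many inequalities hold has a point at which only those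
inequalities are tight that are tight on the whole set: a relative interior point. -/
lemma exists_tight_only {d m : ℕ} {a : Fin m → EuclideanSpace ℝ (Fin d)} {b : Fin m → ℝ}
    {F : Set (EuclideanSpace ℝ (Fin d))} (hF : Convex ℝ F) (hne : F.Nonempty) (S : Finset (Fin m))
    (hS : ∀ x ∈ F, ∀ i ∈ S, inner ℝ (a i) x ≤ b i) :
    ∃ x ∈ F, ∀ i ∈ S, inner ℝ (a i) x = b i → ∀ y ∈ F, inner ℝ (a i) y = b i := by
  classical
  induction S using Finset.induction_on with
  | empty => obtain ⟨x, hx⟩ := hne; exact ⟨x, hx, by simp⟩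
  | insert i S _ ih =>
    obtain ⟨x, hx, hxS⟩ := ih fun x hx j hj => hS x hx j (Finset.mem_insert_of_mem hj)
    by_cases hall : ∀ y ∈ F, inner ℝ (a i) y = b i
    · refine ⟨x, hx, fun j hj => ?_⟩
      rcases Finset.mem_insert.1 hj with rfl | hj
      · exact fun _ => hall
      · exact hxS j hj
    · push Not at hall
      obtain ⟨y, hy, hyi⟩ := hall
      refine ⟨(1 / 2 : ℝ) • x + (1 / 2 : ℝ) • y,
        hF hx hy (by norm_num) (by norm_num) (by norm_num), fun j hj hjeq => ?_⟩
      rw [inner_add_right, inner_smul_right, inner_smul_right] at hjeq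
      have h1 := hS x hx j hj
      have h2 := hS y hy j hj
      rcases Finset.mem_insert.1 hj with rfl | hj
      · exact absurd (by linarith) hyi
      · exact hxS j hj (by linarith)

/-- A direction that does not increase any tight form can be followed a little. -/
lemma exists_pos_move {d m : ℕ} {a : Fin m → EuclideanSpace ℝ (Fin d)} {b : Fin m → ℝ}
    {S : Finset (Fin m)} {z v : EuclideanSpace ℝ (Fin d)} (hz : ∀ i ∈ S, inner ℝ (a i) z ≤ b i)
    (hv : ∀ i ∈ S, inner ℝ (a i) z = b i → inner ℝ (a i) v ≤ 0) :
    ∃ t : ℝ, 0 < t ∧ ∀ i ∈ S, inner ℝ (a i) (z + t • v) ≤ b i := by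
  have h : ∀ᶠ t : ℝ in nhdsWithin 0 (Set.Ioi 0), ∀ i ∈ S, inner ℝ (a i) (z + t • v) ≤ b i := by
    rw [Filter.eventually_all_finset]
    intro i hi
    rcases (hz i hi).lt_or_eq with hlt | heq
    · have hc : Continuous fun t : ℝ => inner ℝ (a i) (z + t • v) := by fun_prop
      have : ∀ᶠ t : ℝ in nhds 0, inner ℝ (a i) (z + t • v) < b i :=
        hc.continuousAt.eventually_lt continuousAt_const (by simpa using hlt)
      exact (this.filter_mono nhdsWithin_le_nhds).mono fun t ht => ht.le
    · filter_upwards [self_mem_nhdsWithin] with t ht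
      rw [inner_add_right, inner_smul_right, heq]
      nlinarith [hv i hi heq, Set.mem_Ioi.1 ht]
  obtain ⟨t, ht, h0⟩ := (h.and self_mem_nhdsWithin).exists
  exact ⟨t, h0, ht⟩

lemma mem_orthogonal_span_image {d m : ℕ} {a : Fin m → EuclideanSpace ℝ (Fin d)}
    {T : Finset (Fin m)} {v : EuclideanSpace ℝ (Fin d)} :
    v ∈ (Submodule.span ℝ (a '' T))ᗮ ↔ ∀ i ∈ T, inner ℝ (a i) v = 0 := by
  constructor
  · exact fun h i hi => h _ (Submodule.subset_span ⟨i, hi, rfl⟩)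
  · intro h u hu
    induction hu using Submodule.span_induction with
    | mem x hx => obtain ⟨i, hi, rfl⟩ := hx; exact h i hi
    | zero => simp
    | add x y _ _ hx hy => rw [inner_add_left, hx, hy, add_zero]
    | smul c x _ hx => rw [inner_smul_left, hx, mul_zero]

lemma le_finrank_orthogonal_span_image {d m : ℕ} (a : Fin m → EuclideanSpace ℝ (Fin d))
    (T : Finset (Fin m)) :
    d ≤ T.card + Module.finrank ℝ (Submodule.span ℝ (a '' T))ᗮ := by
  classical
  have h := Submodule.finrank_add_finrank_orthogonal (Submodule.span ℝ (a '' T))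
  have h2 := finrank_span_finset_le_card (R := ℝ) (T.image a)
  have h3 := Finset.card_image_le (s := T) (f := a)
  rw [Finset.coe_image, Set.finrank] at h2
  rw [finrank_euclideanSpace_fin] at h
  omega

lemma inner_eq_zero_of_mem_vectorSpan {d : ℕ} {F : Set (EuclideanSpace ℝ (Fin d))}
    {u v : EuclideanSpace ℝ (Fin d)} {c : ℝ} (hF : ∀ x ∈ F, inner ℝ u x = c)
    (hv : v ∈ vectorSpan ℝ F) : inner ℝ u v = 0 := by
  rw [vectorSpan_def] at hv
  induction hv using Submodule.span_induction with
  | mem x hx =>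
    obtain ⟨y, hy, z, hz, rfl⟩ := hx
    simp [inner_sub_right, hF y hy, hF z hz]
  | zero => simp
  | add x y _ _ hx hy => rw [inner_add_right, hx, hy, add_zero]
  | smul c x _ hx => rw [inner_smul_right, hx, mul_zero]

/-- The direction of the affine hull of a face is cut out by the equations of the face, as soon as
some point of the face satisfies all the other inequalities strictly. -/
lemma vectorSpan_eq_orthogonal {d m : ℕ} {a : Fin m → EuclideanSpace ℝ (Fin d)} {b : Fin m → ℝ}
    {K : Set (EuclideanSpace ℝ (Fin d))} {S T : Finset (Fin m)}
    (hK : ∀ x, x ∈ K ↔ (∀ i ∈ S, inner ℝ (a i) x ≤ b i) ∧ ∀ i ∈ T, inner ℝ (a i) x = b i)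
    {z : EuclideanSpace ℝ (Fin d)} (hz : z ∈ K) (hzS : ∀ i ∈ S, inner ℝ (a i) z = b i → i ∈ T) :
    vectorSpan ℝ K = (Submodule.span ℝ (a '' T))ᗮ := by
  apply le_antisymm
  · intro v hv
    rw [mem_orthogonal_span_image]
    exact fun i hi => inner_eq_zero_of_mem_vectorSpan (fun x hx => ((hK x).1 hx).2 i hi) hv
  · intro v hv
    rw [mem_orthogonal_span_image] at hv
    obtain ⟨t, ht, hmove⟩ := exists_pos_move (v := v) ((hK z).1 hz).1
      fun i hi h => (hv i (hzS i hi h)).le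
    have hmem : z + t • v ∈ K := by
      refine (hK _).2 ⟨hmove, fun i hi => ?_⟩
      rw [inner_add_right, inner_smul_right, hv i hi, ((hK z).1 hz).2 i hi, mul_zero, add_zero]
    have h := (vectorSpan ℝ K).smul_mem t⁻¹ (vsub_mem_vectorSpan ℝ hmem hz)
    simpa [smul_smul, ht.ne'] using h

lemma polyhedron_convex {d m : ℕ} (a : Fin m → EuclideanSpace ℝ (Fin d)) (b : Fin m → ℝ) :
    Convex ℝ (polyhedron a b) := by
  intro x hx y hy s t hs ht hst i
  rw [inner_add_right, inner_smul_right, inner_smul_right]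
  have : s * b i + t * b i = b i := by rw [← add_mul, hst, one_mul]
  nlinarith [mul_le_mul_of_nonneg_left (hx i) hs, mul_le_mul_of_nonneg_left (hy i) ht]

lemma polyhedron_isClosed {d m : ℕ} (a : Fin m → EuclideanSpace ℝ (Fin d)) (b : Fin m → ℝ) :
    IsClosed (polyhedron a b) := by
  have : polyhedron a b = ⋂ i, {x | inner ℝ (a i) x ≤ b i} := by
    ext x; simp [polyhedron]
  rw [this]
  exact isClosed_iInter fun i => isClosed_le (by fun_prop) continuous_const

/-- A linear form that is constant on a full-dimensional set vanishes. -/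
lemma eq_zero_of_const {d : ℕ} {P : Set (EuclideanSpace ℝ (Fin d))} (hP : HasDim P d)
    {u : EuclideanSpace ℝ (Fin d)} {c : ℝ} (h : ∀ x ∈ P, inner ℝ u x = c) : u = 0 := by
  have htop : vectorSpan ℝ P = ⊤ := by
    apply Submodule.eq_top_of_finrank_eq
    rw [hP.2, finrank_euclideanSpace_fin]
  have : u ∈ vectorSpan ℝ P := htop ▸ Submodule.mem_top
  exact inner_self_eq_zero.1 (inner_eq_zero_of_mem_vectorSpan h this)

lemma exists_interior_point {d m : ℕ} {a : Fin m → EuclideanSpace ℝ (Fin d)} {b : Fin m → ℝ}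
    (hP : HasDim (polyhedron a b) d) :
    ∃ p ∈ polyhedron a b, ∀ i, a i ≠ 0 → inner ℝ (a i) p < b i := by
  obtain ⟨p, hp, h⟩ := exists_tight_only (polyhedron_convex a b) hP.1 Finset.univ
    fun x hx i _ => hx i
  exact ⟨p, hp, fun i hi => lt_of_le_of_ne (hp i) fun he =>
    hi (eq_zero_of_const hP (h i (Finset.mem_univ _) he))⟩

/-! ### Facets and the irredundant subsystem -/

/-- Two valid inequalities that are tight on a common facet are positive multiples of each
other. -/
lemma exists_pos_multiple {d m : ℕ} {a : Fin m → EuclideanSpace ℝ (Fin d)} {b : Fin m → ℝ}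
    (hP : HasDim (polyhedron a b) d) {k : ℕ} (hk : k + 1 = d)
    {F : Set (EuclideanSpace ℝ (Fin d))} (hF : HasDim F k) {i j : Fin m} (hi : a i ≠ 0)
    (hj : a j ≠ 0) (hFi : ∀ x ∈ F, inner ℝ (a i) x = b i)
    (hFj : ∀ x ∈ F, inner ℝ (a j) x = b j) :
    ∃ c : ℝ, 0 < c ∧ a j = c • a i ∧ b j = c * b i := by
  have key : ∀ l : Fin m, a l ≠ 0 → (∀ x ∈ F, inner ℝ (a l) x = b l) →
      vectorSpan ℝ F = (Submodule.span ℝ {a l})ᗮ := by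
    intro l hl hFl
    apply Submodule.eq_of_le_of_finrank_le
    · intro v hv
      rw [Submodule.mem_orthogonal_singleton_iff_inner_right]
      exact inner_eq_zero_of_mem_vectorSpan hFl hv
    · have h := Submodule.finrank_add_finrank_orthogonal (Submodule.span ℝ {a l})
      rw [finrank_span_singleton hl, finrank_euclideanSpace_fin] at h
      rw [hF.2]
      omega
  have hspan : Submodule.span ℝ {a i} = Submodule.span ℝ {a j} := by
    rw [← Submodule.orthogonal_orthogonal (Submodule.span ℝ {a i}), ← key i hi hFi, key j hj hFj,
      Submodule.orthogonal_orthogonal]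
  obtain ⟨c, hc⟩ := Submodule.mem_span_singleton.1 (hspan ▸ Submodule.mem_span_singleton_self (a j))
  obtain ⟨x, hx⟩ := hF.1
  have hb : b j = c * b i := by
    rw [← hFj x hx, ← hFi x hx, ← hc, inner_smul_left]; simp
  obtain ⟨p, _, hp⟩ := exists_interior_point hP
  have h1 := hp i hi
  have h2 := hp j hj
  rw [← hc, inner_smul_left, hb] at h2
  simp only [conj_trivial] at h2
  refine ⟨c, ?_, hc.symm, hb⟩
  by_contra hneg
  nlinarith

lemma polyhedron_inter_isExposed {d m : ℕ} (a : Fin m → EuclideanSpace ℝ (Fin d)) (b : Fin m → ℝ)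
    (i : Fin m) :
    IsExposed ℝ (polyhedron a b) (polyhedron a b ∩ {x | inner ℝ (a i) x = b i}) := by
  rintro ⟨y, hyP, hy⟩
  refine ⟨innerSL ℝ (a i), Set.ext fun x => ⟨?_, ?_⟩⟩
  · rintro ⟨hx, hxi⟩
    refine ⟨hx, fun z hz => ?_⟩
    simp only [Set.mem_ofPred_eq] at hxi
    simpa [hxi] using hz i
  · rintro ⟨hx, hmax⟩
    have := hmax y hyP
    simp only [innerSL_apply_apply, Set.mem_ofPred_eq] at this hy
    exact ⟨hx, le_antisymm (hx i) (hy ▸ this)⟩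

lemma ne_zero_of_facet {d m : ℕ} {a : Fin m → EuclideanSpace ℝ (Fin d)} {b : Fin m → ℝ}
    (hP : HasDim (polyhedron a b) d) {i : Fin m}
    (hi : polyhedron a b ∩ {x | inner ℝ (a i) x = b i} ∈ facets (polyhedron a b)) : a i ≠ 0 := by
  intro h0
  obtain ⟨k, hk, -, ⟨y, hy⟩, hdim⟩ := hi
  have hb : (0 : ℝ) = b i := by simpa [h0] using hy.2
  have : polyhedron a b ∩ {x | inner ℝ (a i) x = b i} = polyhedron a b := by
    ext x; simp [h0, ← hb]
  rw [this, hP.2] at hdim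
  omega

/-- Each inequality of a system without superfluous members cuts out a facet. -/
lemma facet_of_minimal {d m : ℕ} {a : Fin m → EuclideanSpace ℝ (Fin d)} {b : Fin m → ℝ}
    (hP : HasDim (polyhedron a b) d) {S : Finset (Fin m)}
    (hS : ∀ x, (∀ i ∈ S, inner ℝ (a i) x ≤ b i) → x ∈ polyhedron a b) {i : Fin m} (hi : i ∈ S)
    (hmin : ∀ j ∈ S, ¬ ∀ x, (∀ l ∈ S.erase j, inner ℝ (a l) x ≤ b l) → x ∈ polyhedron a b) :
    polyhedron a b ∩ {x | inner ℝ (a i) x = b i} ∈ facets (polyhedron a b) := by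
  have hrep : ∀ x, x ∈ polyhedron a b ↔ ∀ i ∈ S, inner ℝ (a i) x ≤ b i :=
    fun x => ⟨fun h i _ => h i, hS x⟩
  obtain ⟨p, hp, hpint⟩ := exists_interior_point hP
  have hviol : ∀ j ∈ S, ∃ y, (∀ l ∈ S.erase j, inner ℝ (a l) y ≤ b l) ∧ b j < inner ℝ (a j) y := by
    intro j hj
    have := hmin j hj
    push Not at this
    obtain ⟨y, hy, hyP⟩ := this
    refine ⟨y, hy, ?_⟩
    by_contra hle
    push Not at hle
    refine hyP (hS y fun l hl => ?_)
    by_cases hlj : l = j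
    · exact hlj ▸ hle
    · exact hy l (Finset.mem_erase.2 ⟨hlj, hl⟩)
  have hne : ∀ j ∈ S, a j ≠ 0 := by
    intro j hj h0
    obtain ⟨y, -, hy⟩ := hviol j hj
    have := hp j
    simp only [h0, inner_zero_left] at this hy
    linarith
  obtain ⟨y, hy, hyi⟩ := hviol i hi
  have hpi := hpint i (hne i hi)
  -- The point where the segment from `p` to `y` leaves the polyhedron satisfies only the
  -- inequality `i` with equality.
  set t : ℝ := (b i - inner ℝ (a i) p) / (inner ℝ (a i) y - inner ℝ (a i) p) with ht
  have hden : 0 < inner ℝ (a i) y - inner ℝ (a i) p := by linarith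
  have ht0 : 0 < t := div_pos (by linarith) hden
  have ht1 : t < 1 := (div_lt_one hden).2 (by linarith)
  have hinner : ∀ l, inner ℝ (a l) (p + t • (y - p)) =
      (1 - t) * inner ℝ (a l) p + t * inner ℝ (a l) y := by
    intro l
    rw [inner_add_right, inner_smul_right, inner_sub_right]
    ring
  have hzi : inner ℝ (a i) (p + t • (y - p)) = b i := by
    have : t * (inner ℝ (a i) y - inner ℝ (a i) p) = b i - inner ℝ (a i) p :=
      div_mul_cancel₀ _ hden.ne'
    rw [hinner]
    linarith
  have hzl : ∀ l ∈ S, l ≠ i → inner ℝ (a l) (p + t • (y - p)) < b l := by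
    intro l hl hli
    rw [hinner]
    have h1 := hpint l (hne l hl)
    have h2 := hy l (Finset.mem_erase.2 ⟨hli, hl⟩)
    nlinarith
  have hzP : p + t • (y - p) ∈ polyhedron a b := by
    rw [hrep]
    intro l hl
    by_cases hli : l = i
    · exact hli ▸ hzi.le
    · exact (hzl l hl hli).le
  have hspan := vectorSpan_eq_orthogonal (a := a) (b := b) (S := S) (T := {i})
    (K := polyhedron a b ∩ {x | inner ℝ (a i) x = b i})
    (fun x => by simp [hrep x]) (z := p + t • (y - p)) ⟨hzP, hzi⟩
    (fun l hl h => by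
      by_contra hli
      exact (hzl l hl (by simpa using hli)).ne h)
  have hfr := Submodule.finrank_add_finrank_orthogonal (Submodule.span ℝ {a i})
  rw [finrank_span_singleton (hne i hi), finrank_euclideanSpace_fin] at hfr
  rw [Finset.coe_singleton, Set.image_singleton] at hspan
  exact ⟨_, (by omega : Module.finrank ℝ (Submodule.span ℝ {a i})ᗮ + 1 = d),
    polyhedron_inter_isExposed a b i, ⟨_, hzP, hzi⟩, by rw [hspan]⟩

/-- The inequalities of the facets define the polyhedron. -/
lemma mem_polyhedron_iff {d m : ℕ} {a : Fin m → EuclideanSpace ℝ (Fin d)} {b : Fin m → ℝ}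
    (hP : HasDim (polyhedron a b) d) (x : EuclideanSpace ℝ (Fin d)) :
    x ∈ polyhedron a b ↔ ∀ i ∈ facetIdx a b, inner ℝ (a i) x ≤ b i := by
  classical
  refine ⟨fun h i _ => h i, fun hx => ?_⟩
  obtain ⟨S, hS⟩ := Set.Finite.exists_minimal (Set.toFinite
    {S : Finset (Fin m) | ∀ x, (∀ i ∈ S, inner ℝ (a i) x ≤ b i) → x ∈ polyhedron a b})
    ⟨Finset.univ, fun x h i => h i (Finset.mem_univ i)⟩
  refine hS.prop x fun i hi => ?_
  have hfac : ∀ j ∈ S, polyhedron a b ∩ {x | inner ℝ (a j) x = b j} ∈ facets (polyhedron a b) := by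
    intro j hj
    refine facet_of_minimal hP hS.prop hj fun l hl h => ?_
    exact Finset.notMem_erase l S (hS.le_of_le h (Finset.erase_subset l S) hl)
  have hi' := hfac i hi
  -- The first inequality that defines the same facet as `i` belongs to the irredundant subsystem.
  obtain ⟨j, hj⟩ := Set.Finite.exists_minimal (Set.toFinite
    {j : Fin m | polyhedron a b ∩ {x | inner ℝ (a j) x = b j} =
      polyhedron a b ∩ {x | inner ℝ (a i) x = b i}}) ⟨i, rfl⟩
  have hjeq : polyhedron a b ∩ {x | inner ℝ (a j) x = b j} =
      polyhedron a b ∩ {x | inner ℝ (a i) x = b i} := hj.prop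
  have hjJ : j ∈ facetIdx a b := by
    simp only [facetIdx, Finset.mem_filter, Finset.mem_univ, true_and]
    refine ⟨hjeq ▸ hi', fun l hl h => ?_⟩
    exact absurd (hj.le_of_le (h.trans hjeq) hl.le) (not_le.2 hl)
  have hni := ne_zero_of_facet hP hi'
  have hnj := ne_zero_of_facet hP (hjeq ▸ hi')
  obtain ⟨k, hk, hFk⟩ := hi'
  obtain ⟨c, hc, hac, hbc⟩ := exists_pos_multiple hP hk hFk.2 hnj hni
    (fun x hx => (hjeq.symm ▸ hx : x ∈ polyhedron a b ∩ {x | inner ℝ (a j) x = b j}).2)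
    (fun x hx => hx.2)
  rw [hac, hbc, inner_smul_left]
  exact mul_le_mul_of_nonneg_left (hx j hjJ) hc.le

/-! ### Faces of simple polytopes -/

lemma mem_incident {d m : ℕ} {a : Fin m → EuclideanSpace ℝ (Fin d)} {b : Fin m → ℝ}
    {F : Set (EuclideanSpace ℝ (Fin d))} {i : Fin m} :
    i ∈ incident a b F ↔ i ∈ facetIdx a b ∧ ∀ x ∈ F, inner ℝ (a i) x = b i := by
  simp [incident]

lemma mem_facetIdx {d m : ℕ} {a : Fin m → EuclideanSpace ℝ (Fin d)} {b : Fin m → ℝ} {i : Fin m} :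
    i ∈ facetIdx a b ↔ polyhedron a b ∩ {x | inner ℝ (a i) x = b i} ∈ facets (polyhedron a b) ∧
      ∀ j < i, polyhedron a b ∩ {x | inner ℝ (a j) x = b j} ≠
        polyhedron a b ∩ {x | inner ℝ (a i) x = b i} := by
  simp [facetIdx]

lemma exists_relInterior_point {d m : ℕ} {a : Fin m → EuclideanSpace ℝ (Fin d)} {b : Fin m → ℝ}
    {F : Set (EuclideanSpace ℝ (Fin d))} (hF : IsExposed ℝ (polyhedron a b) F)
    (hne : F.Nonempty) :
    ∃ z ∈ F, ∀ i ∈ facetIdx a b, inner ℝ (a i) z = b i → i ∈ incident a b F := by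
  obtain ⟨z, hz, h⟩ := exists_tight_only (hF.convex (polyhedron_convex a b)) hne (facetIdx a b)
    fun x hx i _ => hF.subset hx i
  exact ⟨z, hz, fun i hi he => mem_incident.2 ⟨hi, h i hi he⟩⟩

/-- A face is the intersection of the facets containing it. -/
lemma mem_face_iff {d m : ℕ} {a : Fin m → EuclideanSpace ℝ (Fin d)} {b : Fin m → ℝ}
    (hP : HasDim (polyhedron a b) d) {F : Set (EuclideanSpace ℝ (Fin d))}
    (hF : IsExposed ℝ (polyhedron a b) F) (hne : F.Nonempty) (x : EuclideanSpace ℝ (Fin d)) :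
    x ∈ F ↔ (∀ i ∈ facetIdx a b, inner ℝ (a i) x ≤ b i) ∧
      ∀ i ∈ incident a b F, inner ℝ (a i) x = b i := by
  refine ⟨fun hx => ⟨fun i _ => hF.subset hx i, fun i hi => (mem_incident.1 hi).2 x hx⟩, ?_⟩
  rintro ⟨hxJ, hxF⟩
  obtain ⟨z, hz, hzJ⟩ := exists_relInterior_point hF hne
  -- From a relative interior point `z` of the face one can move a little away from `x`.
  obtain ⟨t, ht, hmove⟩ := exists_pos_move (v := z - x) (fun i _ => hF.subset hz i)
    fun i hi he => by
      rw [inner_sub_right, he, hxF i (hzJ i hi he), sub_self]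
  obtain ⟨l, rfl⟩ := hF hne
  have hxP := (mem_polyhedron_iff hP x).2 hxJ
  have h := hz.2 _ ((mem_polyhedron_iff hP _).2 hmove)
  refine ⟨hxP, fun y hy => (hz.2 y hy).trans ?_⟩
  simp only [map_add, map_smul, map_sub, smul_eq_mul] at h
  nlinarith

lemma face_eq_of_incident_eq {d m : ℕ} {a : Fin m → EuclideanSpace ℝ (Fin d)} {b : Fin m → ℝ}
    (hP : HasDim (polyhedron a b) d) {k : ℕ} {F G : Set (EuclideanSpace ℝ (Fin d))}
    (hF : F ∈ faces (polyhedron a b) k) (hG : G ∈ faces (polyhedron a b) k)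
    (h : incident a b F = incident a b G) : F = G := by
  ext x
  rw [mem_face_iff hP hF.1 hF.2.1, mem_face_iff hP hG.1 hG.2.1, h]

lemma faces_finite {d m : ℕ} {a : Fin m → EuclideanSpace ℝ (Fin d)} {b : Fin m → ℝ}
    (hP : HasDim (polyhedron a b) d) (k : ℕ) : (faces (polyhedron a b) k).Finite :=
  Set.Finite.of_finite_image (f := incident a b) (Set.toFinite _)
    fun _ hF _ hG h => face_eq_of_incident_eq hP hF hG h

/-- Every facet is cut out by a single inequality of the irredundant subsystem. -/
lemma facet_eq {d m : ℕ} {a : Fin m → EuclideanSpace ℝ (Fin d)} {b : Fin m → ℝ}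
    (hP : HasDim (polyhedron a b) d) {G : Set (EuclideanSpace ℝ (Fin d))}
    (hG : G ∈ facets (polyhedron a b)) :
    ∃ i ∈ incident a b G, polyhedron a b ∩ {x | inner ℝ (a i) x = b i} = G := by
  obtain ⟨k, hk, hGk⟩ := hG
  have hmem := mem_face_iff hP hGk.1 hGk.2.1
  have hne : (incident a b G).Nonempty := by
    by_contra hempty
    rw [Finset.not_nonempty_iff_eq_empty] at hempty
    have : G = polyhedron a b := by
      ext x
      rw [hmem, hempty, mem_polyhedron_iff hP]
      simp
    have h1 := hGk.2.2
    rw [this, hP.2] at h1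
    omega
  obtain ⟨i, hi⟩ := hne
  have hi' := mem_incident.1 hi
  refine ⟨i, hi, Set.Subset.antisymm ?_ fun x hx => ⟨hGk.1.subset hx, hi'.2 x hx⟩⟩
  rintro x ⟨hxP, hxi⟩
  refine (hmem x).2 ⟨fun j _ => hxP j, fun j hj => ?_⟩
  have hj' := mem_incident.1 hj
  obtain ⟨c, -, hac, hbc⟩ := exists_pos_multiple hP hk hGk.2
    (ne_zero_of_facet hP (mem_facetIdx.1 hi'.1).1) (ne_zero_of_facet hP (mem_facetIdx.1 hj'.1).1)
    hi'.2 hj'.2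
  have hxi' : inner ℝ (a i) x = b i := hxi
  rw [hac, hbc, inner_smul_left, hxi']
  rfl

lemma card_incident {d m : ℕ} {a : Fin m → EuclideanSpace ℝ (Fin d)} {b : Fin m → ℝ}
    (hP : HasDim (polyhedron a b) d) (hs : IsSimple (polyhedron a b)) {k : ℕ} (hk : k < d)
    {F : Set (EuclideanSpace ℝ (Fin d))} (hF : F ∈ faces (polyhedron a b) k) :
    (incident a b F).card = d - k := by
  rw [← hs k hk F hF, ← Set.ncard_coe_finset]
  have hinj : Set.InjOn (fun i => polyhedron a b ∩ {x | inner ℝ (a i) x = b i})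
      (incident a b F : Set (Fin m)) := by
    intro i hi j hj hij
    have hi' := (mem_facetIdx.1 (mem_incident.1 (Finset.mem_coe.1 hi)).1).2
    have hj' := (mem_facetIdx.1 (mem_incident.1 (Finset.mem_coe.1 hj)).1).2
    rcases lt_trichotomy i j with h | h | h
    · exact absurd hij (hj' i h)
    · exact h
    · exact absurd hij.symm (hi' j h)
  rw [← hinj.ncard_image]
  congr 1
  ext G
  constructor
  · rintro ⟨i, hi, rfl⟩
    have hi' := mem_incident.1 (Finset.mem_coe.1 hi)
    exact ⟨(mem_facetIdx.1 hi'.1).1, fun x hx => ⟨hF.1.subset hx, hi'.2 x hx⟩⟩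
  · rintro ⟨hG, hFG⟩
    obtain ⟨i, hi, hiG⟩ := facet_eq hP hG
    have hi' := mem_incident.1 hi
    exact ⟨i, Finset.mem_coe.2 (mem_incident.2 ⟨hi'.1, fun x hx => hi'.2 x (hFG hx)⟩), hiG⟩

/-- In a simple polytope only the facets used to cut out a face contain it. -/
lemma incident_subset_of_cut {d m : ℕ} {a : Fin m → EuclideanSpace ℝ (Fin d)} {b : Fin m → ℝ}
    (hP : HasDim (polyhedron a b) d) (hs : IsSimple (polyhedron a b)) {k : ℕ} (hk : k < d)
    {K : Set (EuclideanSpace ℝ (Fin d))} (hK : K ∈ faces (polyhedron a b) k)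
    {T : Finset (Fin m)} (hTK : T ⊆ incident a b K)
    (hT : ∀ x, x ∈ polyhedron a b → (∀ i ∈ T, inner ℝ (a i) x = b i) → x ∈ K) :
    incident a b K ⊆ T := by
  classical
  intro j hj
  by_contra hjT
  obtain ⟨z, hz, hzJ⟩ := exists_relInterior_point hK.1 hK.2.1
  have hspan := vectorSpan_eq_orthogonal (mem_face_iff hP hK.1 hK.2.1) hz hzJ
  -- Omitting `j` leaves too few equations to cut out the direction of `K`.
  have hdim := le_finrank_orthogonal_span_image a ((incident a b K).erase j)
  rw [Finset.card_erase_of_mem hj, card_incident hP hs hk hK] at hdim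
  have hfin := hK.2.2
  rw [hspan] at hfin
  obtain ⟨v, hv, hvK⟩ : ∃ v ∈ (Submodule.span ℝ (a '' ((incident a b K).erase j)))ᗮ,
      v ∉ (Submodule.span ℝ (a '' (incident a b K)))ᗮ := by
    by_contra hle
    push Not at hle
    have := Submodule.finrank_mono (R := ℝ) (M := EuclideanSpace ℝ (Fin d)) hle
    omega
  rw [mem_orthogonal_span_image] at hv hvK
  have hvj : inner ℝ (a j) v ≠ 0 := by
    intro h0
    refine hvK fun i hi => ?_
    by_cases hij : i = j
    · exact hij ▸ h0
    · exact hv i (Finset.mem_erase.2 ⟨hij, hi⟩)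
  obtain ⟨u, huj, hu⟩ : ∃ u, inner ℝ (a j) u < 0 ∧
      ∀ i ∈ (incident a b K).erase j, inner ℝ (a i) u = 0 := by
    rcases hvj.lt_or_gt with h | h
    · exact ⟨v, h, hv⟩
    · exact ⟨-v, by simpa using h, fun i hi => by rw [inner_neg_right, hv i hi, neg_zero]⟩
  obtain ⟨t, ht, hmove⟩ := exists_pos_move (v := u) (fun i _ => hK.1.subset hz i) (S := facetIdx a b)
    fun i hi he => by
      by_cases hij : i = j
      · exact hij ▸ huj.le
      · exact (hu i (Finset.mem_erase.2 ⟨hij, hzJ i hi he⟩)).le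
  have hmP := (mem_polyhedron_iff hP _).2 hmove
  have hzj := (mem_incident.1 hj).2 z hz
  have hmem : z + t • u ∈ K := by
    refine hT _ hmP fun i hi => ?_
    rw [inner_add_right, inner_smul_right, (mem_incident.1 (hTK hi)).2 z hz,
      hu i (Finset.mem_erase.2 ⟨fun h => hjT (h ▸ hi), hTK hi⟩), mul_zero, add_zero]
  have := (mem_incident.1 hj).2 _ hmem
  rw [inner_add_right, inner_smul_right, hzj] at this
  nlinarith

/-! ### Weights and support vectors -/

lemma mem_weights_of_ne {n : ℕ} (h1 : n ≠ 1) (h3 : n ≠ 3) {w : Fin n → ℕ} :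
    w ∈ weights n ↔ ∀ j, ∃ l, l < n - 1 ∧ 2 ^ l = w j := by
  unfold weights
  split
  · exact absurd rfl h1
  · exact absurd rfl h3
  · simp

lemma mem_weights_one {w : Fin 1 → ℕ} : w ∈ weights 1 ↔ ∀ j, w j = 1 := by
  simp only [weights, Finset.mem_singleton]
  constructor
  · rintro rfl j; fin_cases j; rfl
  · intro h; ext j; fin_cases j; exact h 0

lemma mem_weights_three {w : Fin 3 → ℕ} :
    w ∈ weights 3 ↔ ∃ j₀, ∀ j, w j = if j = j₀ then 2 else 1 := by
  simp only [weights, Finset.mem_insert, Finset.mem_singleton]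
  constructor
  · rintro (rfl | rfl | rfl)
    · exact ⟨2, by decide⟩
    · exact ⟨1, by decide⟩
    · exact ⟨0, by decide⟩
  · rintro ⟨j₀, h⟩
    obtain rfl : w = fun j => if j = j₀ then 2 else 1 := funext h
    revert j₀
    decide

lemma exists_pow_of_mem_weights {n : ℕ} {w : Fin n → ℕ} (hw : w ∈ weights n) (j : Fin n) :
    ∃ l, w j = 2 ^ l ∧ (l = 0 ∨ l + 2 ≤ n) := by
  by_cases h1 : n = 1
  · subst h1
    exact ⟨0, by simpa using mem_weights_one.1 hw j, Or.inl rfl⟩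
  by_cases h3 : n = 3
  · subst h3
    obtain ⟨j₀, h⟩ := mem_weights_three.1 hw
    by_cases hj : j = j₀
    · exact ⟨1, by simp [h, hj], by omega⟩
    · exact ⟨0, by simp [h, hj], by omega⟩
  · obtain ⟨l, hl, h⟩ := (mem_weights_of_ne h1 h3).1 hw j
    exact ⟨l, h.symm, by omega⟩

/-- A weight vector attached to the index set `A`, extended by zero to all indices. -/
def IsWeighting {m : ℕ} (n : ℕ) (A : Finset (Fin m)) (ω : Fin m → ℕ) : Prop :=
  ∃ h : A.card = n, (fun j => ω (A.orderEmbOfFin h j)) ∈ weights n ∧ ∀ i ∉ A, ω i = 0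

lemma exists_orderEmbOfFin_eq {m n : ℕ} {A : Finset (Fin m)} (h : A.card = n) {i : Fin m}
    (hi : i ∈ A) : ∃ j, A.orderEmbOfFin h j = i := by
  have : i ∈ Set.range (A.orderEmbOfFin h) := by
    rw [Finset.range_orderEmbOfFin]; exact hi
  exact this

lemma sum_orderEmbOfFin {m n : ℕ} {A : Finset (Fin m)} (h : A.card = n) (f : Fin m → ℝ) :
    ∑ j, f (A.orderEmbOfFin h j) = ∑ i ∈ A, f i := by
  have : A = Finset.univ.map (A.orderEmbOfFin h).toEmbedding := by
    ext i
    simp only [Finset.mem_map, Finset.mem_univ, true_and]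
    exact ⟨exists_orderEmbOfFin_eq h, fun ⟨j, hj⟩ => hj ▸ Finset.orderEmbOfFin_mem A h j⟩
  conv_rhs => rw [this, Finset.sum_map]
  rfl

lemma IsWeighting.exists_pow {m n : ℕ} {A : Finset (Fin m)} {ω : Fin m → ℕ}
    (h : IsWeighting n A ω) {i : Fin m} (hi : i ∈ A) :
    ∃ l, ω i = 2 ^ l ∧ (l = 0 ∨ l + 2 ≤ n) := by
  obtain ⟨hc, hw, -⟩ := h
  obtain ⟨j, rfl⟩ := exists_orderEmbOfFin_eq hc hi
  exact exists_pow_of_mem_weights hw j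

lemma card_lt_card_union {α : Type*} [DecidableEq α] {A B : Finset α} (hAB : A ≠ B)
    (hc : A.card = B.card) : A.card < (A ∪ B).card := by
  refine Finset.card_lt_card (Finset.ssubset_iff_subset_ne.2
    ⟨Finset.subset_union_left, fun h => hAB ?_⟩)
  exact (Finset.eq_of_subset_of_card_le (Finset.union_eq_left.1 h.symm) hc.le).symm

/-- If the weighted sums of `s` over two different index sets of equal size are positive and
nonnegative, then the weighted sum of `s` over their union is positive for suitable weights.
On the intersection the two powers of two add up to at most twice and at least once their maximum,
so that their sum can be rounded to a power of two in the direction that increases the total. -/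
lemma IsWeighting.exists_union {m n : ℕ} {A B : Finset (Fin m)} (hAB : A ≠ B) {α β : Fin m → ℕ}
    (hα : IsWeighting n A α) (hβ : IsWeighting n B β) {s : Fin m → ℝ}
    (hsA : 0 < ∑ i ∈ A, (α i : ℝ) * s i) (hsB : 0 ≤ ∑ i ∈ B, (β i : ℝ) * s i) :
    ∃ ω, IsWeighting (A ∪ B).card (A ∪ B) ω ∧ 0 < ∑ i ∈ A ∪ B, (ω i : ℝ) * s i := by
  classical
  have hA0 : ∀ i ∉ A, α i = 0 := hα.choose_spec.2
  have hB0 : ∀ i ∉ B, β i = 0 := hβ.choose_spec.2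
  have hAc : A.card = n := hα.choose
  have hBc : B.card = n := hβ.choose
  have hlt : n < (A ∪ B).card := hAc ▸ card_lt_card_union hAB (hAc.trans hBc.symm)
  have hcard := Finset.card_union_add_card_inter A B
  have hn : 0 < n := by
    rw [← hAc, Finset.card_pos]
    by_contra h
    rw [Finset.not_nonempty_iff_eq_empty] at h
    simp [h] at hsA
  set ω : Fin m → ℕ := fun i =>
    if i ∈ A ∩ B ∧ (α i = β i ∨ 0 ≤ s i) then 2 * max (α i) (β i) else max (α i) (β i) with hω
  have hω0 : ∀ i ∉ A ∪ B, ω i = 0 := by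
    intro i hi
    rw [Finset.mem_union, not_or] at hi
    simp [hω, hA0 i hi.1, hB0 i hi.2]
  refine ⟨ω, ⟨rfl, ?_, hω0⟩, ?_⟩
  · have hone : n ≤ 2 → (∀ i ∈ A, α i = 1) ∧ ∀ i ∈ B, β i = 1 := by
      intro h2
      constructor
      · intro i hi
        obtain ⟨l, hl, hl'⟩ := hα.exists_pow hi
        obtain rfl : l = 0 := by omega
        exact hl
      · intro i hi
        obtain ⟨l, hl, hl'⟩ := hβ.exists_pow hi
        obtain rfl : l = 0 := by omega
        exact hl
    by_cases h3 : (A ∪ B).card = 3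
    · have h2 : n = 2 := by omega
      obtain ⟨hA1, hB1⟩ := hone h2.le
      obtain ⟨i₀, hi₀⟩ := Finset.card_eq_one.1 (show (A ∩ B).card = 1 by omega)
      have hval : ∀ i ∈ A ∪ B, ω i = if i = i₀ then 2 else 1 := by
        intro i hi
        have hiff : i = i₀ ↔ i ∈ A ∩ B := by rw [hi₀, Finset.mem_singleton]
        by_cases hiA : i ∈ A
        · by_cases hiB : i ∈ B
          · simp [hω, hiff, hiA, hiB, hA1, hB1]
          · simp [hω, hiff, hiA, hiB, hA1, hB0]
        · have hiB : i ∈ B := (Finset.mem_union.1 hi).resolve_left hiA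
          simp [hω, hiff, hiA, hA0, hB1, hiB]
      have hi₀' : i₀ ∈ A ∪ B := Finset.inter_subset_union (hi₀ ▸ Finset.mem_singleton_self i₀)
      have : ∀ n (h : (A ∪ B).card = n), n = 3 →
          (fun j => ω ((A ∪ B).orderEmbOfFin h j)) ∈ weights n := by
        rintro n h rfl
        obtain ⟨j₀, hj₀⟩ := exists_orderEmbOfFin_eq h hi₀'
        refine mem_weights_three.2 ⟨j₀, fun j => ?_⟩
        rw [hval _ (Finset.orderEmbOfFin_mem (A ∪ B) h j), ← hj₀]
        simp
      exact this _ rfl h3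
    · refine (mem_weights_of_ne (by omega) h3).2 fun j => ?_
      have hi := Finset.orderEmbOfFin_mem (A ∪ B) rfl j
      set i := (A ∪ B).orderEmbOfFin rfl j
      have hmax : ∃ l, max (α i) (β i) = 2 ^ l ∧ (l = 0 ∨ l + 2 ≤ n) := by
        by_cases hiA : i ∈ A
        · by_cases hiB : i ∈ B
          · rcases max_choice (α i) (β i) with h | h
            · rw [h]; exact hα.exists_pow hiA
            · rw [h]; exact hβ.exists_pow hiB
          · simpa [hB0 i hiB] using hα.exists_pow hiA
        · have hiB : i ∈ B := (Finset.mem_union.1 hi).resolve_left hiA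
          simpa [hA0 i hiA] using hβ.exists_pow hiB
      obtain ⟨l, hl, hln⟩ := hmax
      by_cases hc : i ∈ A ∩ B ∧ (α i = β i ∨ 0 ≤ s i)
      · refine ⟨l + 1, ?_, ?_⟩
        · have := Finset.card_pos.2 ⟨i, hc.1⟩
          -- For `n ≤ 2` the union has at most three elements when the intersection is nonempty, so
          -- `3 ≤ n` here and there is room for one more exponent.
          omega
        · simp only [hω, if_pos hc, hl, pow_succ]
          ring
      · exact ⟨l, by omega, by simp only [hω, if_neg hc, hl]⟩
  · have hA' : ∑ i ∈ A ∪ B, (α i : ℝ) * s i = ∑ i ∈ A, (α i : ℝ) * s i :=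
      (Finset.sum_subset Finset.subset_union_left fun i _ hi => by simp [hA0 i hi]).symm
    have hB' : ∑ i ∈ A ∪ B, (β i : ℝ) * s i = ∑ i ∈ B, (β i : ℝ) * s i :=
      (Finset.sum_subset Finset.subset_union_right fun i _ hi => by simp [hB0 i hi]).symm
    have hle : ∑ i ∈ A ∪ B, ((α i : ℝ) * s i + (β i : ℝ) * s i) ≤
        ∑ i ∈ A ∪ B, (ω i : ℝ) * s i := by
      refine Finset.sum_le_sum fun i _ => ?_
      rw [← add_mul]
      by_cases hc : i ∈ A ∩ B ∧ (α i = β i ∨ 0 ≤ s i)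
      · simp only [hω, if_pos hc]
        rcases hc.2 with h | h
        · simp [h, two_mul]
        · refine mul_le_mul_of_nonneg_right ?_ h
          push_cast
          linarith [le_max_left (α i : ℝ) (β i), le_max_right (α i : ℝ) (β i)]
      · simp only [hω, if_neg hc]
        by_cases hi : i ∈ A ∩ B
        · have hs : s i < 0 := by
            by_contra h
            exact hc ⟨hi, Or.inr (not_lt.1 h)⟩
          refine mul_le_mul_of_nonpos_right ?_ hs.le
          exact_mod_cast max_le (Nat.le_add_right _ _) (Nat.le_add_left _ _)
        · rw [Finset.mem_inter, not_and_or] at hi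
          rcases hi with h | h
          · simp [hA0 i h]
          · simp [hB0 i h]
    rw [Finset.sum_add_distrib, hA', hB'] at hle
    linarith

/-- The excess of the support form of a face is the weighted sum of the excesses of its facets. -/
lemma supportVec_excess {d m : ℕ} {a : Fin m → EuclideanSpace ℝ (Fin d)} {b : Fin m → ℝ}
    {F : Set (EuclideanSpace ℝ (Fin d))} (hF : F ⊆ polyhedron a b) (hne : F.Nonempty) {n : ℕ}
    (h : (incident a b F).card = n) (w : Fin n → ℕ) (ω : Fin m → ℕ)
    (hω : ∀ j, ω ((incident a b F).orderEmbOfFin h j) = w j) (x : EuclideanSpace ℝ (Fin d)) :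
    inner ℝ (supportVec a b F w) x - supportFn (polyhedron a b) (supportVec a b F w) =
      ∑ i ∈ incident a b F, (ω i : ℝ) * (inner ℝ (a i) x - b i) := by
  have hin : ∀ y, inner ℝ (supportVec a b F w) y =
      ∑ i ∈ incident a b F, (ω i : ℝ) * inner ℝ (a i) y := by
    intro y
    rw [← sum_orderEmbOfFin h (fun i => (ω i : ℝ) * inner ℝ (a i) y), supportVec, dif_pos h,
      sum_inner]
    refine Finset.sum_congr rfl fun j _ => ?_
    rw [hω, inner_smul_left]
    simp
  have hsup : supportFn (polyhedron a b) (supportVec a b F w) =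
      ∑ i ∈ incident a b F, (ω i : ℝ) * b i := by
    apply IsGreatest.csSup_eq
    constructor
    · obtain ⟨y, hy⟩ := hne
      refine ⟨y, hF hy, ?_⟩
      simp only
      rw [hin]
      exact Finset.sum_congr rfl fun i hi => by rw [(mem_incident.1 hi).2 y hy]
    · rintro _ ⟨y, hy, rfl⟩
      simp only
      rw [hin]
      exact Finset.sum_le_sum fun i _ => mul_le_mul_of_nonneg_left (hy i) (Nat.cast_nonneg _)
  rw [hin, hsup, ← Finset.sum_sub_distrib]
  exact Finset.sum_congr rfl fun i _ => by ring

lemma exists_weighting {d m : ℕ} {a : Fin m → EuclideanSpace ℝ (Fin d)} {b : Fin m → ℝ}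
    {F : Set (EuclideanSpace ℝ (Fin d))} (hF : F ⊆ polyhedron a b) (hne : F.Nonempty) {n : ℕ}
    (h : (incident a b F).card = n) {w : Fin n → ℕ} (hw : w ∈ weights n) :
    ∃ ω : Fin m → ℕ, IsWeighting n (incident a b F) ω ∧ ∀ x,
      inner ℝ (supportVec a b F w) x - supportFn (polyhedron a b) (supportVec a b F w) =
        ∑ i ∈ incident a b F, (ω i : ℝ) * (inner ℝ (a i) x - b i) := by
  have hval : ∀ j, Function.extend ((incident a b F).orderEmbOfFin h) w 0
      ((incident a b F).orderEmbOfFin h j) = w j :=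
    fun j => ((incident a b F).orderEmbOfFin h).injective.extend_apply w 0 j
  refine ⟨Function.extend ((incident a b F).orderEmbOfFin h) w 0, ⟨h, ?_, fun i hi => ?_⟩,
    supportVec_excess hF hne h w _ hval⟩
  · simpa only [hval] using hw
  · rw [Function.extend_apply']
    · rfl
    · rintro ⟨j, rfl⟩
      exact hi (Finset.orderEmbOfFin_mem _ h j)

/-! ### Descent to smaller violated faces -/

lemma sepDist_le {d : ℕ} {P : Set (EuclideanSpace ℝ (Fin d))} {u v p x : EuclideanSpace ℝ (Fin d)}
    (hp : p ∈ P) (hu : supportFn P u ≤ inner ℝ u x) (hv : supportFn P v ≤ inner ℝ v x) :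
    sepDist P u v ≤ edist p x :=
  (iInf₂_le p hp).trans (iInf₂_le x ⟨hu, hv⟩)

lemma exists_mem_of_sepDist_eq_zero {d : ℕ} {P : Set (EuclideanSpace ℝ (Fin d))}
    (hP : IsCompact P) {u v : EuclideanSpace ℝ (Fin d)} (h : sepDist P u v = 0) :
    ∃ x ∈ P, supportFn P u ≤ inner ℝ u x ∧ supportFn P v ≤ inner ℝ v x := by
  set U : Set (EuclideanSpace ℝ (Fin d)) :=
    {y | supportFn P u ≤ inner ℝ u y ∧ supportFn P v ≤ inner ℝ v y}
  have hclosed : IsClosed U := by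
    have h1 : IsClosed {y : EuclideanSpace ℝ (Fin d) | supportFn P u ≤ inner ℝ u y} :=
      isClosed_le continuous_const (by fun_prop)
    have h2 : IsClosed {y : EuclideanSpace ℝ (Fin d) | supportFn P v ≤ inner ℝ v y} :=
      isClosed_le continuous_const (by fun_prop)
    exact h1.inter h2
  have hinf : ⨅ x ∈ P, Metric.infEDist x U = 0 := h
  rcases P.eq_empty_or_nonempty with rfl | hne
  · simp at hinf
  obtain ⟨x, hx, hmin⟩ := hP.exists_isMinOn hne
    (Metric.continuous_infEDist (s := U)).continuousOn
  refine ⟨x, hx, (Metric.mem_iff_infEDist_zero_of_closed hclosed).2 (le_antisymm ?_ bot_le)⟩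
  rw [← hinf]
  exact le_iInf₂ fun y hy => hmin hy

/-- For positive weights, the support form of a face is maximal only on the face. -/
lemma mem_face_of_maximal {d m : ℕ} {a : Fin m → EuclideanSpace ℝ (Fin d)} {b : Fin m → ℝ}
    (hP : HasDim (polyhedron a b) d) (hs : IsSimple (polyhedron a b)) {k : ℕ} (hk : k < d)
    {F : Set (EuclideanSpace ℝ (Fin d))} (hF : F ∈ faces (polyhedron a b) k)
    {w : Fin (d - k) → ℕ} (hw : w ∈ weights (d - k)) {p : EuclideanSpace ℝ (Fin d)}
    (hp : p ∈ polyhedron a b)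
    (hmax : supportFn (polyhedron a b) (supportVec a b F w) ≤ inner ℝ (supportVec a b F w) p) :
    p ∈ F := by
  obtain ⟨ω, hω, hex⟩ := exists_weighting hF.1.subset hF.2.1 (card_incident hP hs hk hF) hw
  have hsum := hex p
  have hnonpos : ∀ i ∈ incident a b F, (ω i : ℝ) * (inner ℝ (a i) p - b i) ≤ 0 :=
    fun i _ => mul_nonpos_of_nonneg_of_nonpos (Nat.cast_nonneg _) (sub_nonpos.2 (hp i))
  have hzero : ∑ i ∈ incident a b F, (ω i : ℝ) * (inner ℝ (a i) p - b i) = 0 :=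
    le_antisymm (Finset.sum_nonpos hnonpos) (by linarith)
  rw [Finset.sum_eq_zero_iff_of_nonpos hnonpos] at hzero
  refine (mem_face_iff hP hF.1 hF.2.1 p).2 ⟨fun i _ => hp i, fun i hi => ?_⟩
  obtain ⟨l, hl, -⟩ := hω.exists_pow hi
  have hpos : (ω i : ℝ) ≠ 0 := by rw [hl]; positivity
  exact sub_eq_zero.1 ((mul_eq_zero.1 (hzero i hi)).resolve_left hpos)

lemma incident_inter {d m : ℕ} {a : Fin m → EuclideanSpace ℝ (Fin d)} {b : Fin m → ℝ}
    (hP : HasDim (polyhedron a b) d) (hs : IsSimple (polyhedron a b)) {k k' : ℕ} (hk' : k' < d)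
    {F G : Set (EuclideanSpace ℝ (Fin d))} (hF : F ∈ faces (polyhedron a b) k)
    (hG : G ∈ faces (polyhedron a b) k) (hK : F ∩ G ∈ faces (polyhedron a b) k') :
    incident a b (F ∩ G) = incident a b F ∪ incident a b G := by
  have hsub : incident a b F ∪ incident a b G ⊆ incident a b (F ∩ G) := by
    intro i hi
    rw [mem_incident]
    rcases Finset.mem_union.1 hi with h | h
    · exact ⟨(mem_incident.1 h).1, fun x hx => (mem_incident.1 h).2 x hx.1⟩
    · exact ⟨(mem_incident.1 h).1, fun x hx => (mem_incident.1 h).2 x hx.2⟩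
  refine Finset.Subset.antisymm (incident_subset_of_cut hP hs hk' hK hsub fun x hx hT => ?_) hsub
  exact ⟨(mem_face_iff hP hF.1 hF.2.1 x).2
      ⟨fun i _ => hx i, fun i hi => hT i (Finset.mem_union_left _ hi)⟩,
    (mem_face_iff hP hG.1 hG.2.1 x).2
      ⟨fun i _ => hx i, fun i hi => hT i (Finset.mem_union_right _ hi)⟩⟩

/-- If the support inequality of a face is violated and that of another face of the same dimension
is not strictly satisfied, and the two faces meet, then for suitable weights the support inequality
of their intersection is violated. -/
lemma exists_violated_inter {d m : ℕ} {a : Fin m → EuclideanSpace ℝ (Fin d)} {b : Fin m → ℝ}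
    (hP : HasDim (polyhedron a b) d) (hs : IsSimple (polyhedron a b)) {k : ℕ} (hk : k < d)
    {F G : Set (EuclideanSpace ℝ (Fin d))} (hF : F ∈ faces (polyhedron a b) k)
    (hG : G ∈ faces (polyhedron a b) k) (hFG : F ≠ G) (hne : (F ∩ G).Nonempty)
    {w : Fin (d - k) → ℕ} (hw : w ∈ weights (d - k)) {x : EuclideanSpace ℝ (Fin d)}
    (hxF : supportFn (polyhedron a b) (supportVec a b F w) < inner ℝ (supportVec a b F w) x)
    (hxG : supportFn (polyhedron a b) (supportVec a b G w) ≤ inner ℝ (supportVec a b G w) x) :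
    ∃ k' < k, ∃ K ∈ faces (polyhedron a b) k', ∃ w' ∈ weights (d - k'),
      supportFn (polyhedron a b) (supportVec a b K w') < inner ℝ (supportVec a b K w') x := by
  obtain ⟨k', hk'⟩ : ∃ k', F ∩ G ∈ faces (polyhedron a b) k' := ⟨_, hF.1.inter hG.1, hne, rfl⟩
  have hle : k' ≤ k := by
    rw [← hk'.2.2, ← hF.2.2]
    exact Submodule.finrank_mono (vectorSpan_mono ℝ Set.inter_subset_left)
  have hcF := card_incident hP hs hk hF
  have hcG := card_incident hP hs hk hG
  have hk'd : k' < d := hle.trans_lt hk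
  have hcK := card_incident hP hs hk'd hk'
  have hinc := incident_inter hP hs hk'd hF hG hk'
  have hne' : incident a b F ≠ incident a b G := fun h => hFG (face_eq_of_incident_eq hP hF hG h)
  have hlt := card_lt_card_union hne' (hcF.trans hcG.symm)
  obtain ⟨α, hα, hαx⟩ := exists_weighting hF.1.subset hF.2.1 hcF hw
  obtain ⟨β, hβ, hβx⟩ := exists_weighting hG.1.subset hG.2.1 hcG hw
  obtain ⟨ω, hω, hωx⟩ := hα.exists_union hne' hβ (s := fun i => inner ℝ (a i) x - b i)
    (by rw [← hαx]; linarith) (by rw [← hβx]; linarith)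
  rw [← hinc, hcK] at hω
  rw [← hinc] at hωx hlt
  obtain ⟨hc, hω', -⟩ := hω
  refine ⟨k', by omega, F ∩ G, hk', _, hω', ?_⟩
  rw [← supportVec_excess hk'.1.subset hne hc _ ω (fun j => rfl)] at hωx
  linarith

lemma eval_linForm {d : ℕ} (u x : EuclideanSpace ℝ (Fin d)) :
    MvPolynomial.eval (fun j => x j) (linForm u) = inner ℝ u x := by
  simp [linForm, PiLp.inner_apply, mul_comm]

lemma eval_facePoly {d m : ℕ} {a : Fin m → EuclideanSpace ℝ (Fin d)} {b : Fin m → ℝ}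
    (hP : HasDim (polyhedron a b) d) (k : ℕ) {n : ℕ} (w : Fin n → ℕ)
    (x : EuclideanSpace ℝ (Fin d)) :
    MvPolynomial.eval (fun j => x j) (facePoly a b k w) =
      ∏ F ∈ (faces_finite hP k).toFinset, (supportFn (polyhedron a b) (supportVec a b F w) -
        inner ℝ (supportVec a b F w) x) := by
  rw [facePoly, finprod_mem_eq_finite_toFinset_prod _ (faces_finite hP k), map_prod]
  exact Finset.prod_congr rfl fun F _ => by simp [eval_linForm]

/-- A nonnegative product with a negative factor has another factor that is not positive. -/
lemma exists_other_nonpos {α : Type*} {s : Finset α} {f : α → ℝ} (h : 0 ≤ ∏ i ∈ s, f i) {i : α}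
    (hi : i ∈ s) (hneg : f i < 0) : ∃ j ∈ s, j ≠ i ∧ f j ≤ 0 := by
  classical
  by_contra hcon
  push Not at hcon
  rw [← Finset.mul_prod_erase s f hi] at h
  have : 0 < ∏ j ∈ s.erase i, f j := Finset.prod_pos fun j hj =>
    hcon j (Finset.mem_of_mem_erase hj) (Finset.ne_of_mem_erase hj)
  nlinarith

/-- In dimension one, no point lies on the outer side of both vertices. -/
lemma not_violated_both_of_dim_one {m : ℕ} {a : Fin m → EuclideanSpace ℝ (Fin 1)} {b : Fin m → ℝ}
    (hP : HasDim (polyhedron a b) 1) (hs : IsSimple (polyhedron a b))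
    {F G : Set (EuclideanSpace ℝ (Fin 1))} (hF : F ∈ faces (polyhedron a b) 0)
    (hG : G ∈ faces (polyhedron a b) 0) (hFG : F ≠ G)
    {w : Fin (1 - 0) → ℕ} (hw : w ∈ weights (1 - 0)) {x : EuclideanSpace ℝ (Fin 1)}
    (hxF : supportFn (polyhedron a b) (supportVec a b F w) < inner ℝ (supportVec a b F w) x)
    (hxG : supportFn (polyhedron a b) (supportVec a b G w) ≤ inner ℝ (supportVec a b G w) x) :
    False := by
  have hdisj : ∀ y ∈ F, y ∉ G := by
    intro y hyF hyG
    obtain ⟨k', hk', -⟩ := exists_violated_inter hP hs one_pos hF hG hFG ⟨y, hyF, hyG⟩ hw hxF hxG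
    omega
  obtain ⟨f, hf⟩ := hF.2.1
  obtain ⟨g, hg⟩ := hG.2.1
  have hsup : ∀ {H : Set (EuclideanSpace ℝ (Fin 1))}, H ∈ faces (polyhedron a b) 0 →
      ∀ y ∈ H, inner ℝ (supportVec a b H w) y =
        supportFn (polyhedron a b) (supportVec a b H w) := by
    intro H hH y hy
    obtain ⟨ω, -, hex⟩ := exists_weighting hH.1.subset hH.2.1 (card_incident hP hs one_pos hH) hw
    have := hex y
    rw [Finset.sum_eq_zero fun i hi => by rw [(mem_incident.1 hi).2 y hy, sub_self, mul_zero]]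
      at this
    linarith
  have hFf := hsup hF f hf
  have hGg := hsup hG g hg
  have hFg : inner ℝ (supportVec a b F w) g < supportFn (polyhedron a b) (supportVec a b F w) :=
    not_le.1 fun h => hdisj g (mem_face_of_maximal hP hs one_pos hF hw (hG.1.subset hg) h) hg
  have hGf : inner ℝ (supportVec a b G w) f < supportFn (polyhedron a b) (supportVec a b G w) :=
    not_le.1 fun h => hdisj f hf (mem_face_of_maximal hP hs one_pos hG hw (hF.1.subset hf) h)
  have hgf : g - f ≠ 0 := fun h => hdisj f hf (sub_eq_zero.1 h ▸ hg)
  obtain ⟨t, ht⟩ := (finrank_eq_one_iff_of_nonzero' (g - f) hgf).1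
    (by rw [finrank_euclideanSpace_fin]) (x - f)
  obtain rfl : x = f + t • (g - f) := by rw [ht]; abel
  rw [inner_add_right, inner_smul_right, inner_sub_right] at hxF hxG
  have h1 : t < 0 := by
    by_contra h
    nlinarith
  nlinarith

/-- Near the polytope, nonnegativity of all face polynomials forces all support inequalities of
faces to hold. -/
lemma support_le_of_facePoly_nonneg {d m : ℕ} {a : Fin m → EuclideanSpace ℝ (Fin d)} {b : Fin m → ℝ}
    (hb : Bornology.IsBounded (polyhedron a b)) (hP : HasDim (polyhedron a b) d)
    (hs : IsSimple (polyhedron a b)) {ε : ℝ} (hε : IsGoodEps a b ε) {x : EuclideanSpace ℝ (Fin d)}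
    (hnear : 2 ≤ d → ∃ p ∈ polyhedron a b, dist p x ≤ ε)
    (hpoly : ∀ k < d, ∀ w ∈ weights (d - k),
      0 ≤ MvPolynomial.eval (fun j => x j) (facePoly a b k w)) (k : ℕ) :
    k < d → ∀ F ∈ faces (polyhedron a b) k, ∀ w ∈ weights (d - k),
      inner ℝ (supportVec a b F w) x ≤ supportFn (polyhedron a b) (supportVec a b F w) := by
  induction k using Nat.strong_induction_on with
  | _ k ih =>
    intro hk F hF w hw
    by_contra hviol
    rw [not_le] at hviol
    have hprod := hpoly k hk w hw
    rw [eval_facePoly hP] at hprod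
    obtain ⟨G, hG, hGF, hxG⟩ := exists_other_nonpos hprod
      ((faces_finite hP k).mem_toFinset.2 hF) (sub_neg.2 hviol)
    rw [Set.Finite.mem_toFinset] at hG
    rw [sub_nonpos] at hxG
    rcases (show d = 1 ∨ 2 ≤ d by omega) with rfl | hd
    · obtain rfl : k = 0 := by omega
      exact not_violated_both_of_dim_one hP hs hF hG hGF.symm hw hviol hxG
    · obtain ⟨p, hp, hpx⟩ := hnear hd
      have hsep : sepDist (polyhedron a b) (supportVec a b F w) (supportVec a b G w) = 0 := by
        by_contra h0
        have h1 := hε.2 k hk F hF G hG hGF.symm w hw (pos_iff_ne_zero.2 h0)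
        have h2 := sepDist_le hp hviol.le hxG
        rw [edist_dist] at h2
        exact absurd (h1.trans_le h2) (not_lt.2 (ENNReal.ofReal_le_ofReal hpx))
      obtain ⟨y, hy, hyF, hyG⟩ := exists_mem_of_sepDist_eq_zero
        (Metric.isCompact_of_isClosed_isBounded (polyhedron_isClosed a b) hb) hsep
      obtain ⟨k', hk', K, hK, w', hw', hxK⟩ := exists_violated_inter hP hs hk hF hG hGF.symm
        ⟨y, mem_face_of_maximal hP hs hk hF hw hy hyF, mem_face_of_maximal hP hs hk hG hw hy hyG⟩
        hw hviol hxG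
      exact absurd (ih k' hk' (hk'.trans hk) K hK w' hw') (not_le.2 hxK)

/-- The support inequalities of the faces define the polytope: already those of the facets, with
weight one, do. -/
lemma mem_polyhedron_of_facets {d m : ℕ} {a : Fin m → EuclideanSpace ℝ (Fin d)} {b : Fin m → ℝ}
    (hP : HasDim (polyhedron a b) d) (hs : IsSimple (polyhedron a b))
    {x : EuclideanSpace ℝ (Fin d)}
    (h : ∀ k < d, ∀ F ∈ faces (polyhedron a b) k, ∀ w ∈ weights (d - k),
      inner ℝ (supportVec a b F w) x ≤ supportFn (polyhedron a b) (supportVec a b F w)) :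
    x ∈ polyhedron a b := by
  refine (mem_polyhedron_iff hP x).2 fun i hi => ?_
  have hfac := (mem_facetIdx.1 hi).1
  obtain ⟨k, hk, hF⟩ := hfac
  set F := polyhedron a b ∩ {x | inner ℝ (a i) x = b i}
  have hc := card_incident hP hs (by omega) hF
  have hiF : i ∈ incident a b F := mem_incident.2 ⟨hi, fun y hy => hy.2⟩
  have hsingle : incident a b F = {i} := by
    obtain ⟨j, hj⟩ := Finset.card_eq_one.1 (hc.trans (by omega))
    rw [hj] at hiF ⊢
    rw [Finset.mem_singleton.1 hiF]
  have hw : (fun _ => 1 : Fin (d - k) → ℕ) ∈ weights (d - k) := by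
    have : d - k = 1 := by omega
    rw [this]
    exact mem_weights_one.2 fun _ => rfl
  have hle := h k (by omega) F hF _ hw
  have hex := supportVec_excess hF.1.subset hF.2.1 hc _ (fun _ => 1) (fun _ => rfl) x
  rw [hsingle] at hex
  simp only [Finset.sum_singleton, Nat.cast_one, one_mul] at hex
  linarith

/-! ### The approximating polynomial -/

lemma polyhedron_isCompact {d m : ℕ} {a : Fin m → EuclideanSpace ℝ (Fin d)} {b : Fin m → ℝ}
    (hb : Bornology.IsBounded (polyhedron a b)) : IsCompact (polyhedron a b) :=
  Metric.isCompact_of_isClosed_isBounded (polyhedron_isClosed a b) hb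

lemma inner_le_supportFn {d : ℕ} {P : Set (EuclideanSpace ℝ (Fin d))} (hP : IsCompact P)
    (u : EuclideanSpace ℝ (Fin d)) {x : EuclideanSpace ℝ (Fin d)} (hx : x ∈ P) :
    inner ℝ u x ≤ supportFn P u :=
  le_csSup (hP.image (by fun_prop)).bddAbove ⟨x, hx, rfl⟩

lemma supportFn_facetIdx {d m : ℕ} {a : Fin m → EuclideanSpace ℝ (Fin d)} {b : Fin m → ℝ}
    (hb : Bornology.IsBounded (polyhedron a b)) {i : Fin m} (hi : i ∈ facetIdx a b) :
    supportFn (polyhedron a b) (a i) = b i := by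
  obtain ⟨k, -, -, ⟨y, hyP, hy⟩, -⟩ := (mem_facetIdx.1 hi).1
  apply le_antisymm
  · refine csSup_le (Set.Nonempty.image _ ⟨y, hyP⟩) ?_
    rintro _ ⟨z, hz, rfl⟩
    exact hz i
  · have hy' : inner ℝ (a i) y = b i := hy
    rw [← hy']
    exact inner_le_supportFn (polyhedron_isCompact hb) _ hyP

lemma width_pos {d m : ℕ} {a : Fin m → EuclideanSpace ℝ (Fin d)} {b : Fin m → ℝ}
    (hb : Bornology.IsBounded (polyhedron a b)) (hP : HasDim (polyhedron a b) d) {i : Fin m}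
    (hi : i ∈ facetIdx a b) :
    0 < supportFn (polyhedron a b) (a i) + supportFn (polyhedron a b) (-a i) := by
  obtain ⟨p, hp, hpi⟩ := exists_interior_point hP
  have h1 := hpi i (ne_zero_of_facet hP (mem_facetIdx.1 hi).1)
  have h2 := inner_le_supportFn (polyhedron_isCompact hb) (-a i) hp
  rw [inner_neg_left] at h2
  rw [supportFn_facetIdx hb hi]
  linarith

lemma eval_widthForm {d : ℕ} (P : Set (EuclideanSpace ℝ (Fin d)))
    (u x : EuclideanSpace ℝ (Fin d)) :
    MvPolynomial.eval (fun j => x j) (widthForm P u) = (supportFn P u + supportFn P (-u))⁻¹ *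
      (2 * inner ℝ u x - supportFn P u + supportFn P (-u)) := by
  simp [widthForm, eval_linForm]

lemma eval_approxPoly {d m : ℕ} (a : Fin m → EuclideanSpace ℝ (Fin d)) (b : Fin m → ℝ) (q : ℕ)
    (x : EuclideanSpace ℝ (Fin d)) :
    MvPolynomial.eval (fun j => x j) (approxPoly a b q) =
      ∑ i ∈ facetIdx a b, ((facetIdx a b).card : ℝ)⁻¹ *
        MvPolynomial.eval (fun j => x j) (widthForm (polyhedron a b) (a i)) ^ (2 * q) := by
  simp [approxPoly]

lemma eval_approxPoly_le_one {d m : ℕ} {a : Fin m → EuclideanSpace ℝ (Fin d)} {b : Fin m → ℝ}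
    (hb : Bornology.IsBounded (polyhedron a b)) (hP : HasDim (polyhedron a b) d) (q : ℕ)
    {x : EuclideanSpace ℝ (Fin d)} (hx : x ∈ polyhedron a b) :
    MvPolynomial.eval (fun j => x j) (approxPoly a b q) ≤ 1 := by
  have hterm : ∀ i ∈ facetIdx a b,
      MvPolynomial.eval (fun j => x j) (widthForm (polyhedron a b) (a i)) ^ (2 * q) ≤ 1 := by
    intro i hi
    have hw := width_pos hb hP hi
    have h1 := inner_le_supportFn (polyhedron_isCompact hb) (a i) hx
    have h2 := inner_le_supportFn (polyhedron_isCompact hb) (-a i) hx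
    rw [inner_neg_left] at h2
    rw [eval_widthForm, pow_mul, inv_mul_eq_div]
    apply pow_le_one₀ (sq_nonneg _)
    rw [sq_le_one_iff_abs_le_one, abs_le, le_div_iff₀ hw, div_le_iff₀ hw]
    constructor <;> linarith
  rw [eval_approxPoly]
  calc _ ≤ ∑ i ∈ facetIdx a b, ((facetIdx a b).card : ℝ)⁻¹ * 1 :=
        Finset.sum_le_sum fun i hi => mul_le_mul_of_nonneg_left (hterm i hi) (by positivity)
    _ ≤ 1 := by
        rw [Finset.sum_const, nsmul_eq_mul, mul_one]
        exact mul_inv_le_one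

/-- A polytope contains a point whose distance from every facet hyperplane is at least the
`(d+1)`-st part of the width of the polytope in that direction. -/
lemma exists_central_point {d m : ℕ} {a : Fin m → EuclideanSpace ℝ (Fin d)} {b : Fin m → ℝ}
    (hb : Bornology.IsBounded (polyhedron a b)) (hP : HasDim (polyhedron a b) d) :
    ∃ c ∈ polyhedron a b, ∀ i ∈ facetIdx a b,
      supportFn (polyhedron a b) (a i) + supportFn (polyhedron a b) (-a i) ≤
        (d + 1) * (supportFn (polyhedron a b) (a i) - inner ℝ (a i) c) := by
  classical
  have hcomp := polyhedron_isCompact hb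
  set h := supportFn (polyhedron a b)
  obtain ⟨p₀, hp₀⟩ := hP.1
  have hmin : ∀ i, ∃ y ∈ polyhedron a b, inner ℝ (a i) y = -h (-a i) := by
    intro i
    obtain ⟨y, hy, hmax⟩ := hcomp.exists_sSup_image_eq ⟨p₀, hp₀⟩
      (f := fun x => inner ℝ (-a i) x) (by fun_prop)
    refine ⟨y, hy, ?_⟩
    have hmax' : h (-a i) = inner ℝ (-a i) y := hmax
    rw [hmax', inner_neg_left, neg_neg]
  choose y hyP hy using hmin
  have hd : (0 : ℝ) < d + 1 := by positivity
  obtain ⟨c, hc⟩ := Convex.helly_theorem' (𝕜 := ℝ) (s := facetIdx a b)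
    (F := fun i => {x | inner ℝ (a i) x ≤ h (a i) - (h (a i) + h (-a i)) / (d + 1)})
    (fun i _ => convex_halfSpace_le (f := fun x => inner ℝ (a i) x)
      ⟨fun x z => inner_add_right _ x z, fun r x => inner_smul_right _ x r⟩ _)
    (by
      intro I hIJ hI
      rw [finrank_euclideanSpace_fin] at hI
      -- Average the minimizers of the forms in `I`, padded with copies of `p₀` to `d + 1` points.
      refine ⟨((d : ℝ) + 1)⁻¹ • (∑ j ∈ I, y j + ((d : ℝ) + 1 - I.card) • p₀), ?_⟩
      rw [Set.mem_iInter₂]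
      intro i hi
      have hsum : ∑ j ∈ I, inner ℝ (a i) (y j) ≤ -h (-a i) + (I.card - 1) * h (a i) := by
        rw [← Finset.add_sum_erase I _ hi, hy]
        have : ∑ j ∈ I.erase i, inner ℝ (a i) (y j) ≤ ∑ j ∈ I.erase i, h (a i) :=
          Finset.sum_le_sum fun j _ => inner_le_supportFn hcomp _ (hyP j)
        rw [Finset.sum_const, Finset.card_erase_of_mem hi, nsmul_eq_mul,
          Nat.cast_sub (Finset.card_pos.2 ⟨i, hi⟩), Nat.cast_one] at this
        linarith
      have hp : ((d : ℝ) + 1 - I.card) * inner ℝ (a i) p₀ ≤ ((d : ℝ) + 1 - I.card) * h (a i) :=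
        mul_le_mul_of_nonneg_left (inner_le_supportFn hcomp _ hp₀)
          (sub_nonneg.2 (by exact_mod_cast hI))
      rw [Set.mem_ofPred_eq, inner_smul_right, inner_add_right, inner_smul_right, inner_sum,
        inv_mul_le_iff₀ hd, mul_sub, mul_div_cancel₀ _ hd.ne']
      linarith)
  rw [Set.mem_iInter₂] at hc
  have hc' : ∀ i ∈ facetIdx a b, h (a i) + h (-a i) ≤ (d + 1) * (h (a i) - inner ℝ (a i) c) := by
    intro i hi
    have := hc i hi
    rw [Set.mem_ofPred_eq, le_sub_comm, div_le_iff₀ hd] at this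
    linarith
  refine ⟨c, (mem_polyhedron_iff hP c).2 fun i hi => ?_, hc'⟩
  have h1 := (width_pos hb hP hi).trans_le (hc' i hi)
  rw [← supportFn_facetIdx hb hi]
  exact (sub_pos.1 (pos_of_mul_pos_right h1 hd.le)).le

lemma diam_pos {d : ℕ} {P : Set (EuclideanSpace ℝ (Fin d))} (hd : 0 < d)
    (hb : Bornology.IsBounded P) (hP : HasDim P d) : 0 < Metric.diam P := by
  refine lt_of_le_of_ne Metric.diam_nonneg fun h0 => ?_
  have hsub : P.Subsingleton := by
    intro x hx y hy
    have := Metric.dist_le_diam_of_mem hb hx hy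
    rw [← h0] at this
    exact dist_le_zero.1 this
  have := hP.2
  rw [vectorSpan_of_subsingleton ℝ hsub, finrank_bot] at this
  omega

/-- For large exponents, the set where the approximating polynomial is at most one lies within
distance `ε` of the polytope. It is contained in the homothetic copy of the polytope with ratio
`1 + ε / diam` about a central point. -/
lemma exists_dist_le_of_approxPoly_le {d m : ℕ} {a : Fin m → EuclideanSpace ℝ (Fin d)}
    {b : Fin m → ℝ} (hd : 0 < d) (hb : Bornology.IsBounded (polyhedron a b))
    (hP : HasDim (polyhedron a b) d) {ε : ℝ} (hε : 0 < ε) {q : ℕ} (hq : IsGoodExp a b ε q)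
    {x : EuclideanSpace ℝ (Fin d)}
    (hx : MvPolynomial.eval (fun j => x j) (approxPoly a b q) ≤ 1) :
    ∃ p ∈ polyhedron a b, dist p x ≤ ε := by
  obtain ⟨c, hcP, hc⟩ := exists_central_point hb hP
  have hD := diam_pos hd hb hP
  unfold IsGoodExp at hq
  set D := Metric.diam (polyhedron a b)
  set h := supportFn (polyhedron a b)
  have hd1 : (0 : ℝ) < d + 1 := by positivity
  set δ := ε / ((d + 1) * D) with hδ
  have hδ0 : 0 < δ := by positivity
  have hδ2 : 2 * ε / ((d + 1) * D) = 2 * δ := by rw [hδ]; ring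
  rw [hδ2] at hq
  have hbound : ∀ i ∈ facetIdx a b, inner ℝ (a i) x - h (a i) ≤ δ * (h (a i) + h (-a i)) := by
    intro i hi
    have hw := width_pos hb hP hi
    by_contra hcon
    rw [not_le] at hcon
    have hv : 1 + 2 * δ < MvPolynomial.eval (fun j => x j) (widthForm (polyhedron a b) (a i)) := by
      rw [eval_widthForm, inv_mul_eq_div, lt_div_iff₀ hw]
      linarith
    have hcard : (0 : ℝ) < (facetIdx a b).card := by exact_mod_cast Finset.card_pos.2 ⟨i, hi⟩
    have hlog : 0 < Real.log (1 + 2 * δ) := Real.log_pos (by linarith)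
    have hpow : ((facetIdx a b).card : ℝ) < (1 + 2 * δ) ^ (2 * q) := by
      rw [div_lt_iff₀ (by positivity)] at hq
      rw [← Real.log_lt_log_iff hcard (by positivity), Real.log_pow]
      push_cast
      linarith
    have hpow' : (1 + 2 * δ) ^ (2 * q) ≤
        MvPolynomial.eval (fun j => x j) (widthForm (polyhedron a b) (a i)) ^ (2 * q) :=
      pow_le_pow_left₀ (by positivity) hv.le _
    rw [eval_approxPoly] at hx
    have hterm := (Finset.single_le_sum (f := fun i => ((facetIdx a b).card : ℝ)⁻¹ *
      MvPolynomial.eval (fun j => x j) (widthForm (polyhedron a b) (a i)) ^ (2 * q))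
      (fun j _ => mul_nonneg (by positivity) (Even.pow_nonneg (even_two_mul q) _)) hi).trans hx
    rw [inv_mul_le_iff₀ hcard] at hterm
    linarith
  -- The point `p` is the image of `x` under the homothety that shrinks to the polytope.
  set e := ε / D with he
  have he0 : 0 < e := by positivity
  have heδ : e = δ * (d + 1) := by
    rw [he, hδ]; field_simp
  have hxp : x - (c + (1 + e)⁻¹ • (x - c)) = e • ((c + (1 + e)⁻¹ • (x - c)) - c) := by
    have h1 : (1 + e) • ((1 + e)⁻¹ • (x - c)) = x - c := by
      rw [smul_smul, mul_inv_cancel₀ (by positivity), one_smul]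
    rw [add_smul, one_smul] at h1
    rw [add_sub_cancel_left, ← sub_sub, sub_eq_iff_eq_add, add_comm, h1]
  have hpP : c + (1 + e)⁻¹ • (x - c) ∈ polyhedron a b := by
    refine (mem_polyhedron_iff hP _).2 fun i hi => ?_
    have h1 := hbound i hi
    have h2 := mul_le_mul_of_nonneg_left (hc i hi) hδ0.le
    rw [← mul_assoc, ← heδ] at h2
    rw [← supportFn_facetIdx hb hi, inner_add_right, inner_smul_right, inner_sub_right,
      ← le_sub_iff_add_le', inv_mul_le_iff₀ (by positivity)]
    linarith
  refine ⟨_, hpP, ?_⟩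
  rw [dist_comm, dist_eq_norm, hxp, norm_smul, Real.norm_of_nonneg he0.le, ← dist_eq_norm]
  calc e * dist (c + (1 + e)⁻¹ • (x - c)) c ≤ e * D :=
        mul_le_mul_of_nonneg_left (Metric.dist_le_diam_of_mem hb hpP hcP) he0.le
    _ = ε := div_mul_cancel₀ ε hD.ne'

/-! ### Counting the polynomials -/

lemma exists_isGoodEps {d m : ℕ} {a : Fin m → EuclideanSpace ℝ (Fin d)} {b : Fin m → ℝ}
    (hP : HasDim (polyhedron a b) d) : ∃ ε, IsGoodEps a b ε := by
  have hev : ∀ᶠ ε : ℝ in nhdsWithin 0 (Set.Ioi 0), ∀ k ∈ Finset.range d,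
      ∀ F ∈ faces (polyhedron a b) k, ∀ G ∈ faces (polyhedron a b) k, ∀ w ∈ weights (d - k),
      0 < sepDist (polyhedron a b) (supportVec a b F w) (supportVec a b G w) →
      ENNReal.ofReal ε < sepDist (polyhedron a b) (supportVec a b F w) (supportVec a b G w) := by
    rw [Filter.eventually_all_finset]
    intro k _
    rw [Filter.eventually_all_finite (faces_finite hP k)]
    intro F _
    rw [Filter.eventually_all_finite (faces_finite hP k)]
    intro G _
    rw [Filter.eventually_all_finset]
    intro w _
    by_cases h0 : 0 < sepDist (polyhedron a b) (supportVec a b F w) (supportVec a b G w)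
    · have : ∀ᶠ ε : ℝ in nhds 0, ENNReal.ofReal ε <
          sepDist (polyhedron a b) (supportVec a b F w) (supportVec a b G w) :=
        ENNReal.continuous_ofReal.continuousAt.eventually_lt continuousAt_const (by simpa using h0)
      exact (this.filter_mono nhdsWithin_le_nhds).mono fun ε h _ => h
    · exact Filter.Eventually.of_forall fun ε h => absurd h h0
  obtain ⟨ε, h, hε⟩ := (hev.and self_mem_nhdsWithin).exists
  exact ⟨ε, hε, fun k hk F hF G hG _ w hw => h k (Finset.mem_range.2 hk) F hF G hG w hw⟩

/-- The number of polynomials in dimension `d`, counted with repetitions: one for each weight vector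
of each codimension, and the approximating polynomial. -/
def systemSize (d : ℕ) : ℕ :=
  ∑ n ∈ Finset.range d, (weights (n + 1)).card + if 2 ≤ d then 1 else 0

lemma card_weights_le (n : ℕ) (h1 : n ≠ 1) (h3 : n ≠ 3) : (weights n).card ≤ (n - 1) ^ n := by
  have h : weights n =
      Fintype.piFinset fun _ => (Finset.range (n - 1)).image fun l => 2 ^ l := by
    ext w
    rw [mem_weights_of_ne h1 h3]
    simp
  rw [h, Fintype.card_piFinset, Finset.prod_const, Finset.card_univ, Fintype.card_fin]
  exact Nat.pow_le_pow_left (Finset.card_image_le.trans (Finset.card_range _).le) n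

lemma systemSize_two : systemSize 2 = 3 := by decide

lemma systemSize_three : systemSize 3 = 6 := by decide

lemma systemSize_le (d : ℕ) : systemSize d ≤ d ^ d := by
  rcases (show d = 0 ∨ d = 1 ∨ d = 2 ∨ 3 ≤ d by omega) with rfl | rfl | rfl | h
  · decide
  · decide
  · decide
  · induction d, h using Nat.le_induction with
    | base => decide
    | succ d hd ih =>
      have hstep : systemSize (d + 1) = systemSize d + (weights (d + 1)).card := by
        rw [systemSize, systemSize, Finset.sum_range_succ, if_pos (by omega), if_pos (by omega)]
        ring
      have hw := card_weights_le (d + 1) (by omega) (by omega)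
      rw [Nat.add_sub_cancel] at hw
      calc systemSize (d + 1) ≤ d ^ d + d ^ (d + 1) := by omega
        _ = d ^ d * (d + 1) := by ring
        _ ≤ (d + 1) ^ d * (d + 1) :=
            Nat.mul_le_mul_right _ (Nat.pow_le_pow_left (Nat.le_succ d) d)
        _ = (d + 1) ^ (d + 1) := (pow_succ _ _).symm

/-- Without repetitions the system has at most `systemSize d` members. -/
lemma exists_finset_eq_system {d m : ℕ} (a : Fin m → EuclideanSpace ℝ (Fin d)) (b : Fin m → ℝ)
    (q : ℕ) : ∃ S : Finset (MvPolynomial (Fin d) ℝ),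
      (S : Set (MvPolynomial (Fin d) ℝ)) = system a b q ∧ S.card ≤ systemSize d := by
  classical
  refine ⟨(Finset.range d).biUnion (fun k => (weights (d - k)).image fun w => facePoly a b k w) ∪
    if 2 ≤ d then {1 - approxPoly a b q} else ∅, ?_, ?_⟩
  · ext f
    by_cases hd : 2 ≤ d <;> simp [system, hd, eq_comm]
  · refine (Finset.card_union_le _ _).trans (Nat.add_le_add ?_ ?_)
    · refine Finset.card_biUnion_le.trans ?_
      rw [← Finset.sum_range_reflect (fun n => (weights (n + 1)).card)]
      refine Finset.sum_le_sum fun k hk => Finset.card_image_le.trans_eq ?_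
      rw [Finset.mem_range] at hk
      rw [show d - 1 - k + 1 = d - k by omega]
    · split <;> simp

lemma system_nonempty {d m : ℕ} (hd : 0 < d) (a : Fin m → EuclideanSpace ℝ (Fin d))
    (b : Fin m → ℝ) (q : ℕ) : (system a b q).Nonempty := by
  have hw : ∀ n, n = 1 → (fun _ => 1 : Fin n → ℕ) ∈ weights n := by
    rintro n rfl
    exact mem_weights_one.2 fun _ => rfl
  exact ⟨_, Or.inl ⟨d - 1, by omega, _, hw (d - (d - 1)) (by omega), rfl⟩⟩

lemma exists_range_eq_of_card_le {α : Type*} {S : Finset α} {n : ℕ} (hc : S.card ≤ n)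
    (hne : n = 0 ∨ S.Nonempty) : ∃ p : Fin n → α, Set.range p = S := by
  rcases hne with rfl | ⟨s, hs⟩
  · rw [Nat.le_zero, Finset.card_eq_zero] at hc
    exact ⟨Fin.elim0, by simp [hc]⟩
  · refine ⟨fun i => if h : (i : ℕ) < S.card then (S.equivFin.symm ⟨i, h⟩ : α) else s, ?_⟩
    ext f
    constructor
    · rintro ⟨i, rfl⟩
      dsimp only
      split
      · exact Subtype.coe_prop _
      · exact hs
    · intro hf
      refine ⟨⟨S.equivFin ⟨f, hf⟩, (Fin.is_lt _).trans_le hc⟩, ?_⟩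
      simp

lemma polyhedron_eq_nonneg_system {d m : ℕ} {a : Fin m → EuclideanSpace ℝ (Fin d)}
    {b : Fin m → ℝ} (hb : Bornology.IsBounded (polyhedron a b)) (hP : HasDim (polyhedron a b) d)
    (hs : IsSimple (polyhedron a b)) {ε : ℝ} (hε : IsGoodEps a b ε) {q : ℕ}
    (hq : IsGoodExp a b ε q) (x : EuclideanSpace ℝ (Fin d)) :
    x ∈ polyhedron a b ↔ ∀ f ∈ system a b q, 0 ≤ MvPolynomial.eval (fun j => x j) f := by
  constructor
  · rintro hx f (⟨k, -, w, -, rfl⟩ | ⟨-, rfl⟩)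
    · rw [eval_facePoly hP]
      exact Finset.prod_nonneg fun F _ =>
        sub_nonneg.2 (inner_le_supportFn (polyhedron_isCompact hb) _ hx)
    · rw [map_sub, map_one]
      exact sub_nonneg.2 (eval_approxPoly_le_one hb hP q hx)
  · intro h
    refine mem_polyhedron_of_facets hP hs fun k hk =>
      support_le_of_facePoly_nonneg hb hP hs hε (fun hd => ?_)
        (fun k hk w hw => h _ (Or.inl ⟨k, hk, w, hw, rfl⟩)) k hk
    refine exists_dist_le_of_approxPoly_le (by omega) hb hP hε.1 hq ?_
    have := h _ (Or.inr ⟨hd, rfl⟩)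
    rw [map_sub, map_one] at this
    exact sub_nonneg.1 this

end PolyRep

theorem theorem1p1 :
    ∃ μ : ℕ → ℕ, (∀ d, μ d ≤ d ^ d) ∧ μ 2 = 3 ∧ μ 3 = 6 ∧
      ∀ (d m : ℕ) (a : Fin m → EuclideanSpace ℝ (Fin d)) (b : Fin m → ℝ),
        Bornology.IsBounded (PolyRep.polyhedron a b) →
        PolyRep.HasDim (PolyRep.polyhedron a b) d →
        PolyRep.IsSimple (PolyRep.polyhedron a b) →
        (∃ ε : ℝ, PolyRep.IsGoodEps a b ε) ∧
        ∀ ε : ℝ, PolyRep.IsGoodEps a b ε →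
          (∃ q : ℕ, PolyRep.IsGoodExp a b ε q) ∧
          ∀ q : ℕ, PolyRep.IsGoodExp a b ε q →
            ∃ p : Fin (μ d) → MvPolynomial (Fin d) ℝ,
              Set.range p = PolyRep.system a b q ∧
              PolyRep.polyhedron a b = PolyRep.nonnegSet p := by
  refine ⟨PolyRep.systemSize, PolyRep.systemSize_le, PolyRep.systemSize_two,
    PolyRep.systemSize_three, fun d m a b hb hP hs => ⟨PolyRep.exists_isGoodEps hP,
      fun ε hε => ⟨exists_nat_gt _, fun q hq => ?_⟩⟩⟩
  obtain ⟨S, hS, hcard⟩ := PolyRep.exists_finset_eq_system a b q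
  obtain ⟨p, hp⟩ := PolyRep.exists_range_eq_of_card_le hcard (by
    rcases Nat.eq_zero_or_pos d with rfl | hd
    · exact Or.inl rfl
    · exact Or.inr (by rw [← Finset.coe_nonempty, hS]; exact PolyRep.system_nonempty hd a b q))
  refine ⟨p, hp.trans hS, Set.ext fun x => ?_⟩
  rw [PolyRep.polyhedron_eq_nonneg_system hb hP hs hε hq x, ← hS, ← hp]
  exact Set.forall_mem_range
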